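/- **Setting.** Let $\Bbbk$ be a commutative ring with $1$, $Q$ a finite quiver with vertex set $I$, $\overline Q$ its double (for each edge $a:i\to j$ of $Q$ one adds $a^*:j\to i$; $(a^*)^*=a$), $t(a)$, $h(a)$ the tail and head of an edge $a$, and $n\ge 1$. Let $B=\bigoplus_{i\in I}\Bbbk e_i$, $\mathscr B=B^{\otimes n}$, let $E$ be the $B$-bimodule with $\Bbbk$-basis the edges of $\overline Q$ (with $a=e_{h(a)}\,a\,e_{t(a)}$), and $\mathscr E=\bigoplus_{\ell=1}^n B^{\otimes(\ell-1)}\otimes E\otimes B^{\otimes(n-\ell)}$. For $\underline j\in I^n$ write $|_{\underline j}=e_{j_1}\otimes\cdots\otimes e_{j_n}$ and $a_\ell|_{\underline j}=e_{j_1}\otimes\cdots\otimes a e_{j_\ell}\otimes\cdots\otimes e_{j_n}$; if $j_\ell=t(a)$, let $a_\ell(\underline j)$ be $\underline j$ with $j_\ell$ replaced by $h(a)$. Let $s_{\ell m}\in S_n$ be the transposition of $\ell$ and $m$, and put $\sigma(\underline j)=(j_{\sigma^{-1}(1)},\dots,j_{\sigma^{-1}(n)})$. For $\lambda=\sum_i\lambda_ie_i\in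 B$ and $\nu\in\Bbbk$, the algebra $\mathscr A_{n,\lambda,\nu}$ is the quotient of $T_{\mathscr B}\mathscr E\rtimes\Bbbk[S_n]$ by the relations (i) for all $\ell$, $\underline j$: $\big(\sum_{a\in Q}[a,a^*]-\lambda\big)_\ell\big|_{\underline j}=\nu\sum_{m\ne\ell,\;j_m=j_\ell}s_{\ell m}\big|_{\underline j}$; (ii) for all $\ell\neq m$, $a,b\in\overline Q$ and $\underline j$ with $j_\ell=t(a)$, $j_m=t(b)$: $a_\ell|_{b_m(\underline j)}b_m|_{\underline j}-b_m|_{a_\ell(\underline j)}a_\ell|_{\underline j}$ equals $\nu s_{\ell m}|_{\underline j}$ if $b\in Q$ and $a=b^*$, equals $-\nu s_{\ell m}|_{\underline j}$ if $a\in Q$ and $b=a^*$, and is $0$ otherwise. Let $i$ be a vertex that is a sink of $Q$ (no edge of $Q$ has tail $i$; in particular there is no edge-loop at $i$), and $R=\{a\in Q\mid h(a)=i\}$. Let $(r_i\lambda)_j=\lambda_j-(\epsilon_i,\epsilon_j)\lambda_i$, where $(\alpha,\beta)=\langle\alpha,\beta\rangle+\langle\beta,\alpha\rangle$ is the symmetrization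 of the Ringel form $\langle\alpha,\beta\rangle=\sum_{i\in I}\alpha_i\beta_i-\sum_{a\in Q}\alpha_{t(a)}\beta_{h(a)}$ on $\mathbb Z^I$. **The construction.** Let $V$ be a left $\mathscr A_{n,\lambda,\nu}$-module. Put $V_{\underline j}=|_{\underline j}V$ and $\Delta(\underline j)=\{m\mid j_m=i\}$. For $D\subseteq\Delta(\underline j)$ let $\mathcal X(D)$ be the set of maps $\xi:D\to R$; for $\xi\in\mathcal X(D)$ let $t(\underline j,\xi)\in I^n$ have $m$-th entry $t(\xi(m))$ if $m\in D$ and $j_m$ otherwise, and let $V(\underline j,D)=\bigoplus_{\xi\in\mathcal X(D)}V_{t(\underline j,\xi)}$, with projections $\pi_{\underline j,\xi}$ onto and inclusions $\mu_{\underline j,\xi}$ of the summands. For $p\in D$ let $\rho_p:\mathcal X(D)\to\mathcal X(D\setminus\{p\})$ be restriction, and set $$\pi_{\underline j,p}=\sum_{\xi\in\mathcal X(D)}\mu_{\underline j,\rho_p(\xi)}\,\xi(p)_p\big|_{t(\underline j,\xi)}\,\pi_{\underline j,\xi}:V(\underline j,D)\to V(\underline j,D\setminus\{p\}),$$ $$\mu_{\underline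 j,p}=\sum_{\xi\in\mathcal X(D)}\mu_{\underline j,\xi}\,\xi(p)^*_p\big|_{t(\underline j,\rho_p(\xi))}\,\pi_{\underline j,\rho_p(\xi)}:V(\underline j,D\setminus\{p\})\to V(\underline j,D).$$ For $\sigma\in S_n$ and $\xi\in\mathcal X(D)$ let $\sigma(\xi)=\xi\circ\sigma^{-1}\in\mathcal X(\sigma(D))$, and let $\sigma|_{\underline j}=\sum_{\xi\in\mathcal X(D)}\mu_{\sigma(\underline j),\sigma(\xi)}\,\sigma\,\pi_{\underline j,\xi}:V(\underline j,D)\to V(\sigma(\underline j),\sigma(D))$. Put $$V'_{\underline j}=\bigcap_{p\in\Delta(\underline j)}\ker\big(\pi_{\underline j,p}\big)\subseteq V(\underline j,\Delta(\underline j)),\qquad F_i(V)=\bigoplus_{\underline j\in I^n}V'_{\underline j}$$ (so $V'_{\underline j}=V_{\underline j}$ if $\Delta(\underline j)=\emptyset$). For $r\in R$ and $\ell\in D$ let $\tau_{r,\ell,D}:\mathcal X(D\setminus\{\ell\})\to\mathcal X(D)$ be extension by $\ell\mapsto r$. Let $$\tau^!_{r,\ell,\underline j,D}=\sum_{\eta\in\mathcal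 X(D\setminus\{\ell\})}\mu_{r^*_\ell(\underline j),\eta}\,\pi_{\underline j,\tau_{r,\ell,D}(\eta)}:V(\underline j,D)\to V(r^*_\ell(\underline j),D\setminus\{\ell\})$$ be the projection, and $$\tau_{r,\ell,\underline j,D\,!}=\sum_{\eta\in\mathcal X(D\setminus\{\ell\})}\mu_{\underline j,\tau_{r,\ell,D}(\eta)}\,\pi_{r^*_\ell(\underline j),\eta}:V(r^*_\ell(\underline j),D\setminus\{\ell\})\to V(\underline j,D)$$ the inclusion. For $a\in\overline Q$ and $\underline j$ with $j_\ell=t(a)$, and with $\Delta=\Delta(\underline j)$, define $a'_\ell|_{\underline j}$ on $V'_{\underline j}$ by * (I) if $h(a),t(a)\ne i$: $a'_\ell|_{\underline j}=\sum_{\xi\in\mathcal X(\Delta)}\mu_{a_\ell(\underline j),\xi}\,a_\ell|_{t(\underline j,\xi)}\,\pi_{\underline j,\xi}$; * (II) if $t(a)=i$: $a'_\ell|_{\underline j}=\tau^!_{a^*,\ell,\underline j,\Delta}$; * (III) if $h(a)=i$: $a'_\ell|_{\underline j}=\big(-\lambda_i+\mu_{a_\ell(\underline j),\ell}\,\pi_{a_\ell(\underline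 j),\ell}+\nu\sum_{m\in\Delta}s_{m\ell}|_{a_\ell(\underline j)}\big)\,\tau_{a,\ell,a_\ell(\underline j),\Delta\cup\{\ell\}\,!}$. **Proposition.** The maps $\sigma|_{\underline j}$ send $V'_{\underline j}$ into $V'_{\sigma(\underline j)}$, the maps $a'_\ell|_{\underline j}$ send $V'_{\underline j}$ into $V'_{a_\ell(\underline j)}$, and $F_i(V)$ is an $\mathscr A_{n,r_i\lambda,\nu}$-module (with the $\Bbbk$-module structure induced from $V$) on which $|_{\underline j}$ acts as the projection onto $V'_{\underline j}$, $\sigma\in S_n$ acts by the maps $\sigma|_{\underline j}$, and $a_\ell|_{\underline j}$ acts by $a'_\ell|_{\underline j}$ on $V'_{\underline j}$ and by $0$ on the other summands. Moreover, for every homomorphism $f:V\to W$ of $\mathscr A_{n,\lambda,\nu}$-modules, applying $f$ to every component gives an $\mathscr A_{n,r_i\lambda,\nu}$-linear map $F_i(f):F_i(V)\to F_i(W)$, and $V\mapsto F_i(V)$, $f\mapsto F_i(f)$ is a functor $F_i:\mathscr A_{n,\lambda,\nu}\text{-mod}\to\mathscr A_{n,r_i\lambda,\nu}\text{-mod}$.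 -/

import Mathlib

open CategoryTheory

universe uk uI w v

namespace WreathQuiver

noncomputable section

/-! ## Quivers, doubles, the Ringel form and the dual reflections -/

section Quivers

variable {I : Type uI} [Quiver.{w} I]

variable (I) in
/-- The edges of the double of a quiver: `Sum.inl a` is the edge `a` of the quiver itself,
`Sum.inr a` is the reverse edge `a*`. -/
abbrev DoubleEdge : Type (max uI w) := Quiver.Total.{w, uI} I ⊕ Quiver.Total.{w, uI} I

/-- The tail `t(a)` of an edge of the double. -/
def tail : DoubleEdge I → I
  | Sum.inl a => a.left
  | Sum.inr a => a.right

/-- The head `h(a)` of an edge of the double. -/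
def head : DoubleEdge I → I
  | Sum.inl a => a.right
  | Sum.inr a => a.left

/-- The involution `a ↦ a*` on the edges of the double. -/
def star (a : DoubleEdge I) : DoubleEdge I := a.swap

/-- The Ringel form `⟨α, β⟩ = ∑ α_i β_i - ∑_{a ∈ Q} α_{t(a)} β_{h(a)}` on `ℤ^I`. -/
def ringelForm [Fintype I] [Fintype (Quiver.Total.{w, uI} I)] (α β : I → ℤ) : ℤ :=
  ∑ i, α i * β i - ∑ a : Quiver.Total.{w, uI} I, α a.left * β a.right

/-- The symmetrized form `(α, β) = ⟨α, β⟩ + ⟨β, α⟩`. -/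
def symForm [Fintype I] [Fintype (Quiver.Total.{w, uI} I)] (α β : I → ℤ) : ℤ :=
  ringelForm α β + ringelForm β α

/-- The dual reflection `(r_i λ)_j = λ_j - (ε_i, ε_j) λ_i`. -/
def dualReflection [Fintype I] [DecidableEq I] [Fintype (Quiver.Total.{w, uI} I)]
    {k : Type uk} [CommRing k] (i : I) (lam : I → k) : I → k :=
  fun j => lam j - ((symForm (Pi.single i 1) (Pi.single j 1) : ℤ) : k) * lam i

/-- `σ(j) = (j_{σ⁻¹(1)}, …, j_{σ⁻¹(n)})`. -/
def permTuple {n : ℕ} (σ : Equiv.Perm (Fin n)) (j : Fin n → I) : Fin n → I :=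
  fun m => j (σ⁻¹ m)

/-- `a_ℓ(j)`: the `ℓ`-th entry of `j` is replaced by `h(a)`. -/
def moveTuple {n : ℕ} [DecidableEq I] (a : DoubleEdge I) (l : Fin n) (j : Fin n → I) :
    Fin n → I :=
  Function.update j l (head a)

end Quivers

/-! ## The algebra -/

section TheAlgebra

/-- Generators of `T_𝓑 𝓔 ⋊ k[S_n]`: the idempotents `|_j = e_{j_1} ⊗ ⋯ ⊗ e_{j_n}` of `𝓑 = B^{⊗ n}`,
the elements `a_ℓ|_j = e_{j_1} ⊗ ⋯ ⊗ a e_{j_ℓ} ⊗ ⋯ ⊗ e_{j_n}` of `𝓔_ℓ`, and the permutations. -/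
inductive Gen (I : Type uI) [Quiver.{w} I] (n : ℕ) : Type (max uI w)
  | idem (j : Fin n → I) : Gen I n
  | edge (a : DoubleEdge I) (l : Fin n) (j : Fin n → I) : Gen I n
  | perm (σ : Equiv.Perm (Fin n)) : Gen I n

variable (k : Type uk) [CommRing k] {I : Type uI} [Fintype I] [DecidableEq I]
  [Quiver.{w} I] {n : ℕ}

/-- A generator as an element of the free algebra. -/
abbrev gen (x : Gen I n) : FreeAlgebra k (Gen I n) := FreeAlgebra.ι k x

/-- Defining relations of `T_𝓑 𝓔 ⋊ k[S_n]`. The `|_j` are a complete set of orthogonal idempotents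
(a `k`-basis of `𝓑`); `a_ℓ|_j` is zero if `j_ℓ ≠ t(a)` (as then `a e_{j_ℓ} = 0`), and otherwise
these elements are a `k`-basis of `𝓔`, on which `𝓑` acts on the left through `|_{a_ℓ(j)}` and on
the right through `|_j`; and `S_n` acts by permuting the tensor factors. -/
inductive SmashRel : FreeAlgebra k (Gen I n) → FreeAlgebra k (Gen I n) → Prop
  | idem_self (j : Fin n → I) :
      SmashRel (gen k (.idem j) * gen k (.idem j)) (gen k (.idem j))
  | idem_ne (j j' : Fin n → I) (h : j ≠ j') :
      SmashRel (gen k (.idem j) * gen k (.idem j')) 0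
  | idem_sum : SmashRel (∑ j : Fin n → I, gen k (.idem j)) 1
  | edge_zero (a : DoubleEdge I) (l : Fin n) (j : Fin n → I) (h : j l ≠ tail a) :
      SmashRel (gen k (.edge a l j)) 0
  | edge_left (a : DoubleEdge I) (l : Fin n) (j : Fin n → I) :
      SmashRel (gen k (.idem (moveTuple a l j)) * gen k (.edge a l j)) (gen k (.edge a l j))
  | edge_right (a : DoubleEdge I) (l : Fin n) (j : Fin n → I) :
      SmashRel (gen k (.edge a l j) * gen k (.idem j)) (gen k (.edge a l j))
  | perm_one : SmashRel (gen k (.perm 1)) 1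
  | perm_mul (σ σ' : Equiv.Perm (Fin n)) :
      SmashRel (gen k (.perm (σ * σ'))) (gen k (.perm σ) * gen k (.perm σ'))
  | perm_idem (σ : Equiv.Perm (Fin n)) (j : Fin n → I) :
      SmashRel (gen k (.perm σ) * gen k (.idem j))
        (gen k (.idem (permTuple σ j)) * gen k (.perm σ))
  | perm_edge (σ : Equiv.Perm (Fin n)) (a : DoubleEdge I) (l : Fin n) (j : Fin n → I) :
      SmashRel (gen k (.perm σ) * gen k (.edge a l j))
        (gen k (.edge a (σ l) (permTuple σ j)) * gen k (.perm σ))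

variable (I n) in
/-- The algebra `T_𝓑 𝓔 ⋊ k[S_n]`. -/
abbrev SmashAlg : Type (max uk uI w) := RingQuot (SmashRel k (I := I) (n := n))

/-- A generator as an element of `T_𝓑 𝓔 ⋊ k[S_n]`. -/
def smashGen (x : Gen I n) : SmashAlg k I n := RingQuot.mkAlgHom k (SmashRel k) (gen k x)

variable {k} [Fintype (Quiver.Total.{w, uI} I)] [DecidableEq (Quiver.Total.{w, uI} I)]

/-- The relations (i) and (ii), imposed on `T_𝓑 𝓔 ⋊ k[S_n]`. In the first one,
`(∑_{a ∈ Q} [a, a*])_ℓ|_j` is written out as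
`∑_{a ∈ Q} (a_ℓ|_{a*_ℓ(j)} a*_ℓ|_j - a*_ℓ|_{a_ℓ(j)} a_ℓ|_j)`; the products that do not start at
`j_ℓ` vanish. -/
inductive WreathRel (lam : I → k) (ν : k) : SmashAlg k I n → SmashAlg k I n → Prop
  | rel_one (l : Fin n) (j : Fin n → I) :
      WreathRel lam ν
        ((∑ a : Quiver.Total.{w, uI} I,
            (smashGen k (.edge (Sum.inl a) l (moveTuple (Sum.inr a) l j))
                * smashGen k (.edge (Sum.inr a) l j)
              - smashGen k (.edge (Sum.inr a) l (moveTuple (Sum.inl a) l j))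
                * smashGen k (.edge (Sum.inl a) l j)))
          - lam (j l) • smashGen k (.idem j))
        (ν • ∑ m : Fin n with m ≠ l ∧ j m = j l,
          smashGen k (.perm (Equiv.swap l m)) * smashGen k (.idem j))
  | rel_two (l m : Fin n) (hlm : l ≠ m) (a b : DoubleEdge I) (j : Fin n → I)
      (ha : j l = tail a) (hb : j m = tail b) :
      WreathRel lam ν
        (smashGen k (.edge a l (moveTuple b m j)) * smashGen k (.edge b m j)
          - smashGen k (.edge b m (moveTuple a l j)) * smashGen k (.edge a l j))
        (if b.isLeft ∧ a = star b then
            ν • (smashGen k (.perm (Equiv.swap l m)) * smashGen k (.idem j))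
          else if a.isLeft ∧ b = star a then
            -(ν • (smashGen k (.perm (Equiv.swap l m)) * smashGen k (.idem j)))
          else 0)

variable (n) in
/-- The algebra `𝓐_{n, λ, ν}`. -/
abbrev WreathAlg (lam : I → k) (ν : k) : Type (max uk uI w) :=
  RingQuot (WreathRel (n := n) lam ν)

/-- The image of a generator in `𝓐_{n, λ, ν}`. -/
def toAlg (lam : I → k) (ν : k) (x : Gen I n) : WreathAlg n lam ν :=
  RingQuot.mkAlgHom k (WreathRel lam ν) (smashGen k x)

end TheAlgebra

/-! ## The reflection functor at a sink -/

section Reflection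

/-- `R = {a ∈ Q | h(a) = i}`. -/
abbrev EdgesInto {I : Type uI} [Quiver.{w} I] (i : I) : Type (max uI w) :=
  {a : Quiver.Total.{w, uI} I // a.right = i}

/-- Partial maps `ξ` from `[1, n]` to `R`. A map `D → R` is the same thing as a partial map with
domain `D`. -/
abbrev PartialMap {I : Type uI} [Quiver.{w} I] (n : ℕ) (i : I) : Type (max uI w) :=
  Fin n → Option (EdgesInto i)

variable {k : Type uk} [CommRing k] {I : Type uI} [Fintype I] [DecidableEq I]
  [Quiver.{w} I] [Fintype (Quiver.Total.{w, uI} I)]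
  [DecidableEq (Quiver.Total.{w, uI} I)] {n : ℕ} {i : I}

/-- The domain of a partial map. -/
def dom (ξ : PartialMap n i) : Finset (Fin n) := {m | (ξ m).isSome}

/-- `𝒳(D)`, the set of maps `D → R`. -/
def mapsOn (i : I) (D : Finset (Fin n)) : Finset (PartialMap n i) := {ξ | dom ξ = D}

/-- `Δ(j) = {m | j_m = i}`. -/
def Delta (i : I) (j : Fin n → I) : Finset (Fin n) := {m | j m = i}

/-- `t(j, ξ)`: the tuple whose `m`-th entry is `j_m` for `m` outside the domain of `ξ`, and
`t(ξ(m))` for `m` in it. -/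
def tailTuple (j : Fin n → I) (ξ : PartialMap n i) : Fin n → I :=
  fun m => (ξ m).elim (j m) (fun r => r.1.left)

/-- `σ(ξ) : m ↦ ξ(σ⁻¹ m)`. -/
def permMap (σ : Equiv.Perm (Fin n)) (ξ : PartialMap n i) : PartialMap n i := fun m => ξ (σ⁻¹ m)

/-- The restriction map `ρ_p : 𝒳(D) → 𝒳(D \ {p})`. -/
def restr (p : Fin n) (ξ : PartialMap n i) : PartialMap n i := Function.update ξ p none

/-- The extension map `τ_{r,ℓ,D} : 𝒳(D \ {ℓ}) → 𝒳(D)`, giving `ℓ` the value `r`. -/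
def extend (r : EdgesInto i) (l : Fin n) (η : PartialMap n i) : PartialMap n i :=
  Function.update η l (some r)

variable (lam : I → k) (ν : k) (i : I) (V : Type v) [AddCommGroup V] [Module (WreathAlg n lam ν) V]

/-- `V_j = |_j V`. -/
def vertexSpace (j : Fin n → I) : AddSubgroup V :=
  (Module.toAddMonoidEnd (WreathAlg n lam ν) V (toAlg lam ν (.idem j))).range

/-- All families of elements of `V` indexed by the partial maps `ξ`. The direct sums `V(j, D)` are
realized inside this group, and the maps between them are given by formulas on it. -/
abbrev Amb : Type (max uI w v) := PartialMap n i → V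

/-- `V(j, D) = ⊕_{ξ ∈ 𝒳(D)} V_{t(j, ξ)}`: the families `f` with `f ξ ∈ V_{t(j, ξ)}` for
`ξ ∈ 𝒳(D)` and `f ξ = 0` for all other `ξ`. -/
def sumSpace (j : Fin n → I) (D : Finset (Fin n)) : AddSubgroup (Amb (n := n) i V) :=
  AddSubgroup.pi Set.univ
    (fun ξ => if ξ ∈ mapsOn i D then vertexSpace lam ν V (tailTuple j ξ) else ⊥)

variable {i V} in
/-- For an element `c` of the algebra and partial maps `ξ`, `η`: the composite of the projection
onto the summand of `ξ`, the action of `c`, and the inclusion of the summand of `η`. -/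
def block (η ξ : PartialMap n i) (c : WreathAlg n lam ν) : Amb (n := n) i V →+ Amb (n := n) i V :=
  ((AddMonoidHom.single (fun _ : PartialMap n i => V) η).comp
    (Module.toAddMonoidEnd (WreathAlg n lam ν) V c)).comp
      (Pi.evalAddMonoidHom (fun _ : PartialMap n i => V) ξ)

/-- `σ|_j : V(j, D) → V(σ(j), σ(D))`. -/
def permOp (D : Finset (Fin n)) (σ : Equiv.Perm (Fin n)) :
    Amb (n := n) i V →+ Amb (n := n) i V :=
  ∑ ξ ∈ mapsOn i D, block lam ν (permMap σ ξ) ξ (toAlg lam ν (.perm σ))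

/-- `π_{j,p} : V(j, D) → V(j, D \ {p})`, the sum over `ξ ∈ 𝒳(D)` of
`μ_{j,ρ_p(ξ)} ∘ ξ(p)_p|_{t(j,ξ)} ∘ π_{j,ξ}`, for `p ∈ D`. -/
def piOp (j : Fin n → I) (D : Finset (Fin n)) (p : Fin n) :
    Amb (n := n) i V →+ Amb (n := n) i V :=
  ∑ ξ ∈ mapsOn i D, (ξ p).elim 0 (fun r =>
    block lam ν (restr p ξ) ξ (toAlg lam ν (.edge (Sum.inl r.1) p (tailTuple j ξ))))

/-- `μ_{j,p} : V(j, D \ {p}) → V(j, D)`, the sum over `ξ ∈ 𝒳(D)` of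
`μ_{j,ξ} ∘ ξ(p)*_p|_{t(j,ρ_p(ξ))} ∘ π_{j,ρ_p(ξ)}`, for `p ∈ D`. -/
def muOp (j : Fin n → I) (D : Finset (Fin n)) (p : Fin n) :
    Amb (n := n) i V →+ Amb (n := n) i V :=
  ∑ ξ ∈ mapsOn i D, (ξ p).elim 0 (fun r =>
    block lam ν ξ (restr p ξ) (toAlg lam ν (.edge (Sum.inr r.1) p (tailTuple j (restr p ξ)))))

/-- `V_j(D) = ⋂_{p ∈ D} Ker π_{j,p}`, inside `V(j, D)`; it is `V(j, ∅) = V_j` for `D = ∅`. -/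
def kerSpace (j : Fin n → I) (D : Finset (Fin n)) : AddSubgroup (Amb (n := n) i V) :=
  sumSpace lam ν i V j D ⊓ ⨅ p ∈ D, (piOp lam ν i V j D p).ker

variable (n) in
/-- `F_i(V) = ⊕_{j ∈ I^n} V'_j` with `V'_j = V_j(Δ(j))`; the index set `I^n` is finite. -/
def reflSpace : AddSubgroup ((Fin n → I) → Amb (n := n) i V) :=
  AddSubgroup.pi Set.univ (fun j => kerSpace lam ν i V j (Delta i j))

/-- Case (I): `a_ℓ|_{j,D} : V(j, D) → V(a_ℓ(j), D)`. -/
def edgeOp (a : DoubleEdge I) (l : Fin n) (j : Fin n → I) (D : Finset (Fin n)) :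
    Amb (n := n) i V →+ Amb (n := n) i V :=
  ∑ ξ ∈ mapsOn i D, block lam ν ξ ξ (toAlg lam ν (.edge a l (tailTuple j ξ)))

variable {i}

/-- The projection `τ^!_{r,ℓ,j,D} : V(j, D) → V(r*_ℓ(j), D \ {ℓ})`. -/
def tauUpper (r : EdgesInto i) (l : Fin n) (D : Finset (Fin n)) :
    Amb (n := n) i V →+ Amb (n := n) i V :=
  ∑ η ∈ mapsOn i (D.erase l), block lam ν η (extend r l η) 1

/-- The inclusion `τ_{r,ℓ,j,D !} : V(r*_ℓ(j), D \ {ℓ}) → V(j, D)`. -/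
def tauLower (r : EdgesInto i) (l : Fin n) (D : Finset (Fin n)) :
    Amb (n := n) i V →+ Amb (n := n) i V :=
  ∑ η ∈ mapsOn i (D.erase l), block lam ν (extend r l η) η 1

/-- Multiplication by a scalar `c ∈ k`. -/
def scalarOp (i : I) (c : k) : Amb (n := n) i V →+ Amb (n := n) i V :=
  Module.toAddMonoidEnd (WreathAlg n lam ν) (Amb (n := n) i V) (algebraMap k (WreathAlg n lam ν) c)

/-- `θ_{a,ℓ,j,D} : V(j, D) → V(a_ℓ(j), D ∪ {ℓ})`, the composite of
`-λ_i + μ_{a_ℓ(j),ℓ} π_{a_ℓ(j),ℓ} + ν ∑_{m ∈ D} s_{mℓ}|_{a_ℓ(j)}` and `τ_{a,ℓ,a_ℓ(j),D ∪ {ℓ} !}`. -/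
def theta (a : EdgesInto i) (l : Fin n) (j : Fin n → I) (D : Finset (Fin n)) :
    Amb (n := n) i V →+ Amb (n := n) i V :=
  (- scalarOp lam ν V i (lam i)
    + (muOp lam ν i V (moveTuple (Sum.inl a.1) l j) (insert l D) l).comp
        (piOp lam ν i V (moveTuple (Sum.inl a.1) l j) (insert l D) l)
    + (scalarOp lam ν V i ν).comp
        (∑ m ∈ D, permOp lam ν i V (insert l D) (Equiv.swap m l))).comp
    (tauLower lam ν V a l (insert l D))

variable (i)

/-- `a'_ℓ|_j : V'_j → V'_{a_ℓ(j)}`, for a sink `i` and `j_ℓ = t(a)`. As `i` is a sink, the edges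
of the double with head `i` are the `a ∈ R` (Case III), and those with tail `i` are the `a*` with
`a ∈ R` (Case II); the remaining edges are those of Case I. -/
def primeOp : (a : DoubleEdge I) → (l : Fin n) → (j : Fin n → I) →
    (Amb (n := n) i V →+ Amb (n := n) i V)
  | Sum.inl a, l, j =>
      if h : a.right = i then theta lam ν V ⟨a, h⟩ l j (Delta i j)
      else edgeOp lam ν i V (Sum.inl a) l j (Delta i j)
  | Sum.inr a, l, j =>
      if h : a.right = i then tauUpper lam ν V ⟨a, h⟩ l (Delta i j)
      else edgeOp lam ν i V (Sum.inr a) l j (Delta i j)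

/-- A module structure over `𝓐_{n, r_i λ, ν}` on `F_i(V)` is *the* action of the construction if
`|_j` acts as the projection onto `V'_j`, `σ ∈ S_n` acts by the maps `σ|_j : V'_j → V'_{σ(j)}`,
`a_ℓ|_j` acts by `a'_ℓ|_j : V'_j → V'_{a_ℓ(j)}` (and by zero on the other summands), and the
scalars in `k` act as they do on `V`. -/
structure IsReflectionAction
    (M : Module (WreathAlg n (dualReflection i lam) ν) (reflSpace n lam ν i V)) : Prop where
  scalar : ∀ (c : k) (x : reflSpace n lam ν i V) (j : Fin n → I) (ξ : PartialMap n i),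
    (algebraMap k (WreathAlg n (dualReflection i lam) ν) c • x).1 j ξ
      = algebraMap k (WreathAlg n lam ν) c • x.1 j ξ
  idem : ∀ (j : Fin n → I) (x : reflSpace n lam ν i V),
    (toAlg (dualReflection i lam) ν (.idem j) • x).1 = Pi.single j (x.1 j)
  perm : ∀ (σ : Equiv.Perm (Fin n)) (x : reflSpace n lam ν i V) (j : Fin n → I),
    (toAlg (dualReflection i lam) ν (.perm σ) • x).1 (permTuple σ j)
      = permOp lam ν i V (Delta i j) σ (x.1 j)
  edge : ∀ (a : DoubleEdge I) (l : Fin n) (j : Fin n → I), j l = tail a →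
    ∀ x : reflSpace n lam ν i V,
      (toAlg (dualReflection i lam) ν (.edge a l j) • x).1
        = Pi.single (moveTuple a l j) (primeOp lam ν i V a l j (x.1 j))

variable {V} {W : Type v} [AddCommGroup W] [Module (WreathAlg n lam ν) W]

variable {lam ν i} in
theorem block_map (f : V →ₗ[WreathAlg n lam ν] W) (η ξ : PartialMap n i) (c : WreathAlg n lam ν)
    (x : Amb (n := n) i V) (ζ : PartialMap n i) :
    f (block lam ν η ξ c x ζ) = block lam ν η ξ c (fun ξ' => f (x ξ')) ζ := by
  change f (Pi.single (M := fun _ => V) η (c • x ξ) ζ)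
    = Pi.single (M := fun _ => W) η (c • f (x ξ)) ζ
  by_cases h : ζ = η
  · subst h
    rw [Pi.single_eq_same, Pi.single_eq_same, map_smul]
  · rw [Pi.single_eq_of_ne h, Pi.single_eq_of_ne h, map_zero]

variable {lam ν i} in
theorem piOp_map (f : V →ₗ[WreathAlg n lam ν] W) (j : Fin n → I) (D : Finset (Fin n)) (p : Fin n)
    (x : Amb (n := n) i V) (ζ : PartialMap n i) :
    f (piOp lam ν i V j D p x ζ) = piOp lam ν i W j D p (fun ξ => f (x ξ)) ζ := by
  simp only [piOp, AddMonoidHom.finsetSum_apply, Finset.sum_apply, map_sum]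
  refine Finset.sum_congr rfl fun ξ _ => ?_
  cases h : ξ p with
  | none => simp
  | some r => simpa using block_map f _ _ _ x ζ

theorem mem_sumSpace (j : Fin n → I) (D : Finset (Fin n)) (x : Amb (n := n) i V) :
    x ∈ sumSpace lam ν i V j D ↔
      ∀ ξ, (dom ξ = D → x ξ ∈ vertexSpace lam ν V (tailTuple j ξ)) ∧ (dom ξ ≠ D → x ξ = 0) := by
  simp only [sumSpace, AddSubgroup.mem_pi, Set.mem_univ, forall_const]
  refine forall_congr' fun ξ => ?_
  by_cases h : dom ξ = D <;> simp [mapsOn, h]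

theorem mem_kerSpace (j : Fin n → I) (D : Finset (Fin n)) (x : Amb (n := n) i V) :
    x ∈ kerSpace lam ν i V j D ↔
      x ∈ sumSpace lam ν i V j D ∧ ∀ p ∈ D, piOp lam ν i V j D p x = 0 := by
  simp [kerSpace, AddSubgroup.mem_inf, AddSubgroup.mem_iInf, AddMonoidHom.mem_ker]

theorem mem_reflSpace (x : (Fin n → I) → Amb (n := n) i V) :
    x ∈ reflSpace n lam ν i V ↔ ∀ j, x j ∈ kerSpace lam ν i V j (Delta i j) := by
  simp [reflSpace, AddSubgroup.mem_pi]

theorem reflSpace_map (f : V →ₗ[WreathAlg n lam ν] W) (x : reflSpace n lam ν i V) :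
    (fun j ξ => f (x.1 j ξ)) ∈ reflSpace n lam ν i W := by
  rw [mem_reflSpace]
  intro j
  have hx := (mem_reflSpace lam ν i x.1).1 x.2 j
  rw [mem_kerSpace, mem_sumSpace] at hx ⊢
  refine ⟨fun ξ => ⟨fun h => ?_, fun h => ?_⟩, fun p hp => ?_⟩
  · obtain ⟨y, hy⟩ := (hx.1 ξ).1 h
    refine ⟨f y, ?_⟩
    rw [← hy]
    exact (map_smul f _ y).symm
  · rw [(hx.1 ξ).2 h, map_zero]
  · funext ζ
    have h3 := piOp_map f j (Delta i j) p (x.1 j) ζ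
    rw [hx.2 p hp] at h3
    simpa using h3.symm

/-- The map `F_i(f) : F_i(V) → F_i(W)` induced by a homomorphism `f : V → W`: apply `f` in every
component. -/
def reflMap (f : V →ₗ[WreathAlg n lam ν] W) : reflSpace n lam ν i V →+ reflSpace n lam ν i W where
  toFun x := ⟨fun j ξ => f (x.1 j ξ), reflSpace_map lam ν i f x⟩
  map_zero' := by ext; simp
  map_add' x y := by ext; simp

/-- The functor `V ↦ F_i(V)`, `f ↦ F_i(f)`, formed with given module structures on the `F_i(V)` for
which all `F_i(f)` are linear. -/
def reflFunctor
    (M : ∀ V : ModuleCat.{v} (WreathAlg n lam ν),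
      Module (WreathAlg n (dualReflection i lam) ν) (reflSpace n lam ν i V))
    (lin : ∀ (V W : ModuleCat.{v} (WreathAlg n lam ν)) (f : V →ₗ[WreathAlg n lam ν] W)
      (c : WreathAlg n (dualReflection i lam) ν) (x : reflSpace n lam ν i V),
      reflMap lam ν i f (c • x) = c • reflMap lam ν i f x) :
    ModuleCat.{v} (WreathAlg n lam ν) ⥤
      ModuleCat.{max uI w v} (WreathAlg n (dualReflection i lam) ν) where
  obj V := @ModuleCat.of _ _ (reflSpace n lam ν i V) _ (M V)
  map {V W} f :=
    letI := M V
    letI := M W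
    ModuleCat.ofHom { reflMap lam ν i f.hom with map_smul' := lin V W f.hom }
  map_id V := by
    let := M V
    rfl
  map_comp {U V W} f g := by
    let := M U
    let := M V
    let := M W
    rfl

end Reflection

end

end WreathQuiver

/-! The sums over `𝒳(D)` in the construction are restrictions of operators defined on all families
`(x_ξ)` at once, without reference to a tuple or a domain. The letters are: the global arrows `a_ℓ =
∑_j a_ℓ|_j` acting on components; `raise` and `lower`, which write or erase a value `r` in one slot
of `ξ`; and permutations acting on slots and on `V` simultaneously. In them `π_p` becomes
`contract`, `∑_r lower_r r_p`, and `μ_p` becomes `expand`, `∑_r raise_r r*_p`. The new edge actions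
are `a_ℓ` in case (I), `lower` in case (II), and `shift` after `raise` in case (III), with `shift =
-λ_i + μ_ℓ π_ℓ + ν ∑ s_{mℓ}`. Tuples and domains survive only in membership statements, and the
proposition becomes a calculation with commutation rules.

Two rules carry the relations of the algebra. `contract_expand` is relation (ii): `π_p μ_q = μ_q π_p
- ν s_{pq}` for a filled slot `p` and an empty slot `q` with `j_q = i`. `contract_expand_self` is
relation (i): `π_p μ_p = λ_i` when every other slot at `i` is filled; because `i` is a sink, filling
those slots has moved them away from `i`, so no transposition term is left. Together they show that
`shift` after `raise` lands in the intersection of kernels (`shift_raise_mem_kerSpace`).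

For relation (ii), the delicate case has both heads at `i`. The operators `X_ℓ = μ_ℓ π_ℓ + ν ∑_{p ∈
D} s_{pℓ}` satisfy `[X_ℓ, X_m] = ν s_{ℓm} (X_ℓ - X_m)`, and enlarging the index set of the outer
shift adds exactly the `ν s_{ℓm}` that compensates this (`shift_shift`). In the mixed case the same
extra summand, between `lower` and `raise`, is the right-hand side of the relation
(`lower_shift_raise`).

For relation (i) at a slot with `j_ℓ = i`, the sum of `raise_r lower_r` is the identity and `π_ℓ`
vanishes on the kernel, leaving `-λ_i + ν ∑ s_{mℓ}`, and `(r_i λ)_i = -λ_i`. At another vertex, each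
edge from `j_ℓ` to `i` replaces `r* r` by `-λ_i + r* r + ν(…)`: the scalars turn `λ` into `r_i λ`,
and the transposition terms cancel those which the old relation has for slots filled by an edge with
tail `j_ℓ` (`primeAct_sum_commutator`).

Every operator is built from slot maps and the action of the algebra, so it commutes with applying a
homomorphism in each component; this gives functoriality. -/

set_option linter.unusedSectionVars false

namespace WreathQuiver

noncomputable section

/-! ### Consequences of the defining relations in the algebra, and the global arrows. -/

section AlgebraRelations

variable {k : Type uk} [CommRing k] {I : Type uI} [Fintype I] [DecidableEq I]
  [Quiver.{w} I] [Fintype (Quiver.Total.{w, uI} I)]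
  [DecidableEq (Quiver.Total.{w, uI} I)] {n : ℕ} (lam : I → k) (ν : k)

theorem toAlg_eq (x : Gen I n) : toAlg lam ν x =
    RingQuot.mkAlgHom k (WreathRel lam ν) (RingQuot.mkAlgHom k (SmashRel k) (gen k x)) := rfl

theorem toAlg_rel {x y : FreeAlgebra k (Gen I n)} (h : SmashRel k x y) :
    RingQuot.mkAlgHom k (WreathRel lam ν) (RingQuot.mkAlgHom k (SmashRel k) x) =
      RingQuot.mkAlgHom k (WreathRel lam ν) (RingQuot.mkAlgHom k (SmashRel k) y) := by
  rw [RingQuot.mkAlgHom_rel k h]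

theorem idem_mul_self (j : Fin n → I) :
    toAlg lam ν (.idem j) * toAlg lam ν (.idem j) = toAlg lam ν (.idem j) := by
  simpa [toAlg_eq] using toAlg_rel lam ν (SmashRel.idem_self (k := k) j)

theorem idem_mul_ne {j j' : Fin n → I} (h : j ≠ j') :
    toAlg lam ν (.idem j) * toAlg lam ν (.idem j') = 0 := by
  simpa [toAlg_eq] using toAlg_rel lam ν (SmashRel.idem_ne (k := k) j j' h)

theorem sum_idem : ∑ j : Fin n → I, toAlg lam ν (.idem j) = 1 := by
  simpa [toAlg_eq] using toAlg_rel lam ν (SmashRel.idem_sum (k := k) (I := I) (n := n))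

theorem edge_eq_zero {a : DoubleEdge I} {l : Fin n} {j : Fin n → I} (h : j l ≠ tail a) :
    toAlg lam ν (.edge a l j) = 0 := by
  simpa [toAlg_eq] using toAlg_rel lam ν (SmashRel.edge_zero (k := k) a l j h)

theorem idem_mul_edge (a : DoubleEdge I) (l : Fin n) (j : Fin n → I) :
    toAlg lam ν (.idem (moveTuple a l j)) * toAlg lam ν (.edge a l j)
      = toAlg lam ν (.edge a l j) := by
  simpa [toAlg_eq] using toAlg_rel lam ν (SmashRel.edge_left (k := k) a l j)

theorem edge_mul_idem (a : DoubleEdge I) (l : Fin n) (j : Fin n → I) :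
    toAlg lam ν (.edge a l j) * toAlg lam ν (.idem j) = toAlg lam ν (.edge a l j) := by
  simpa [toAlg_eq] using toAlg_rel lam ν (SmashRel.edge_right (k := k) a l j)

theorem perm_one : toAlg lam ν (.perm (1 : Equiv.Perm (Fin n))) = 1 := by
  simpa [toAlg_eq] using toAlg_rel lam ν (SmashRel.perm_one (k := k) (I := I) (n := n))

theorem perm_mul (σ σ' : Equiv.Perm (Fin n)) :
    toAlg lam ν (.perm (σ * σ')) = toAlg lam ν (.perm σ) * toAlg lam ν (.perm σ') := by
  simpa [toAlg_eq] using toAlg_rel lam ν (SmashRel.perm_mul (k := k) (I := I) σ σ')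

theorem perm_mul_idem (σ : Equiv.Perm (Fin n)) (j : Fin n → I) :
    toAlg lam ν (.perm σ) * toAlg lam ν (.idem j)
      = toAlg lam ν (.idem (permTuple σ j)) * toAlg lam ν (.perm σ) := by
  simpa [toAlg_eq] using toAlg_rel lam ν (SmashRel.perm_idem (k := k) σ j)

theorem perm_mul_edge (σ : Equiv.Perm (Fin n)) (a : DoubleEdge I) (l : Fin n) (j : Fin n → I) :
    toAlg lam ν (.perm σ) * toAlg lam ν (.edge a l j)
      = toAlg lam ν (.edge a (σ l) (permTuple σ j)) * toAlg lam ν (.perm σ) := by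
  simpa [toAlg_eq] using toAlg_rel lam ν (SmashRel.perm_edge (k := k) σ a l j)

theorem commutator_relation (l : Fin n) (j : Fin n → I) :
    (∑ a : Quiver.Total.{w, uI} I,
        (toAlg lam ν (.edge (Sum.inl a) l (moveTuple (Sum.inr a) l j))
            * toAlg lam ν (.edge (Sum.inr a) l j)
          - toAlg lam ν (.edge (Sum.inr a) l (moveTuple (Sum.inl a) l j))
            * toAlg lam ν (.edge (Sum.inl a) l j)))
      - lam (j l) • toAlg lam ν (.idem j)
    = ν • ∑ m : Fin n with m ≠ l ∧ j m = j l,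
        toAlg lam ν (.perm (Equiv.swap l m)) * toAlg lam ν (.idem j) := by
  have h := RingQuot.mkAlgHom_rel k (WreathRel.rel_one (lam := lam) (ν := ν) l j)
  simp only [map_sub, map_sum, map_mul, map_smul] at h
  exact h

theorem two_slot_relation {l m : Fin n} (hlm : l ≠ m) (a b : DoubleEdge I) (j : Fin n → I)
    (ha : j l = tail a) (hb : j m = tail b) :
    toAlg lam ν (.edge a l (moveTuple b m j)) * toAlg lam ν (.edge b m j)
      - toAlg lam ν (.edge b m (moveTuple a l j)) * toAlg lam ν (.edge a l j)
    = if b.isLeft ∧ a = star b then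
        ν • (toAlg lam ν (.perm (Equiv.swap l m)) * toAlg lam ν (.idem j))
      else if a.isLeft ∧ b = star a then
        -(ν • (toAlg lam ν (.perm (Equiv.swap l m)) * toAlg lam ν (.idem j)))
      else 0 := by
  have h := RingQuot.mkAlgHom_rel k (WreathRel.rel_two (lam := lam) (ν := ν) l m hlm a b j ha hb)
  simp only [map_sub, map_mul] at h
  refine h.trans ?_
  split_ifs <;> simp only [map_neg, map_smul, map_mul, map_zero] <;> rfl

/-- The element `a_ℓ = ∑_j a_ℓ|_j`. -/
def arrow (a : DoubleEdge I) (l : Fin n) : WreathAlg n lam ν :=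
  ∑ j : Fin n → I, toAlg lam ν (.edge a l j)

theorem edge_mul_idem_ne (a : DoubleEdge I) (l : Fin n) {j j' : Fin n → I} (h : j ≠ j') :
    toAlg lam ν (.edge a l j) * toAlg lam ν (.idem j') = 0 := by
  rw [← edge_mul_idem, mul_assoc, idem_mul_ne _ _ h, mul_zero]

theorem arrow_mul_idem (a : DoubleEdge I) (l : Fin n) (j : Fin n → I) :
    arrow lam ν a l * toAlg lam ν (.idem j) = toAlg lam ν (.edge a l j) := by
  rw [arrow, Finset.sum_mul, Finset.sum_eq_single j, edge_mul_idem]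
  · exact fun b _ hb => edge_mul_idem_ne _ _ _ _ hb
  · simp

/-- The target tuple of `b_m|_j` selects a single summand of `a_ℓ`, so products of global arrows
recover the tuple-indexed products of the relations. -/
theorem arrow_mul_edge (a b : DoubleEdge I) (l m : Fin n) (j : Fin n → I) :
    arrow lam ν a l * toAlg lam ν (.edge b m j)
      = toAlg lam ν (.edge a l (moveTuple b m j)) * toAlg lam ν (.edge b m j) := by
  rw [← idem_mul_edge, ← mul_assoc, arrow_mul_idem, idem_mul_edge]

/-- The permutation of `I^n` given by `permTuple`. -/
def permTupleEquiv (σ : Equiv.Perm (Fin n)) : (Fin n → I) ≃ (Fin n → I) where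
  toFun := permTuple σ
  invFun := permTuple σ⁻¹
  left_inv j := by funext m; simp [permTuple]
  right_inv j := by funext m; simp [permTuple]

theorem perm_mul_arrow (σ : Equiv.Perm (Fin n)) (a : DoubleEdge I) (l : Fin n) :
    toAlg lam ν (.perm σ) * arrow lam ν a l = arrow lam ν a (σ l) * toAlg lam ν (.perm σ) := by
  simp only [arrow, Finset.mul_sum, Finset.sum_mul, perm_mul_edge]
  exact (permTupleEquiv σ).sum_comp
    (fun j => toAlg lam ν (.edge a (σ l) j) * toAlg lam ν (.perm σ))

theorem eq_of_mul_idem {x y : WreathAlg n lam ν}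
    (h : ∀ j, x * toAlg lam ν (.idem j) = y * toAlg lam ν (.idem j)) : x = y := by
  rw [← mul_one x, ← mul_one y, ← sum_idem, Finset.mul_sum, Finset.mul_sum]
  exact Finset.sum_congr rfl fun j _ => h j

/-- Relation (ii) has a nonzero right-hand side only for an edge against its reverse. If one of the
tails does not match the tuple, both products vanish, so no condition on tails is needed. -/
theorem arrow_mul_comm {l m : Fin n} (hlm : l ≠ m) {a b : DoubleEdge I}
    (h : a ≠ star b) :
    arrow lam ν a l * arrow lam ν b m = arrow lam ν b m * arrow lam ν a l := by
  have h' : b ≠ star a := by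
    rintro rfl
    exact h (by simp [star])
  refine eq_of_mul_idem lam ν fun j => ?_
  rw [mul_assoc, mul_assoc, arrow_mul_idem, arrow_mul_idem, arrow_mul_edge, arrow_mul_edge]
  by_cases ha : j l = tail a
  · by_cases hb : j m = tail b
    · have := two_slot_relation lam ν hlm a b j ha hb
      rw [if_neg (fun t => h t.2), if_neg (fun t => h' t.2)] at this
      exact sub_eq_zero.1 this
    · rw [edge_eq_zero lam ν hb, edge_eq_zero lam ν (a := b), mul_zero, zero_mul]
      rwa [moveTuple, Function.update_of_ne hlm.symm]
  · rw [edge_eq_zero lam ν ha, edge_eq_zero lam ν (a := a), mul_zero, zero_mul]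
    rwa [moveTuple, Function.update_of_ne hlm]

/-! ### The relations as identities on vectors of the spaces `V_j`. -/

section VertexSpaces

variable {V : Type v} [AddCommGroup V] [Module (WreathAlg n lam ν) V]

theorem wreathAlg_sub_smul (a b : WreathAlg n lam ν) (x : V) : (a - b) • x = a • x - b • x :=
  sub_smul a b x

theorem wreathAlg_neg_smul (a : WreathAlg n lam ν) (x : V) : (-a) • x = -(a • x) :=
  neg_smul a x

theorem mem_vertexSpace {j : Fin n → I} {x : V} :
    x ∈ vertexSpace lam ν V j ↔ toAlg lam ν (.idem j) • x = x := by
  constructor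
  · rintro ⟨y, rfl⟩
    change toAlg lam ν (.idem j) • toAlg lam ν (.idem j) • y = toAlg lam ν (.idem j) • y
    rw [smul_smul, idem_mul_self]
  · intro h
    exact ⟨x, h⟩

variable {lam ν} {j : Fin n → I} {x : V}

/-- This removes tuples from the formulas: `|_j` is the identity on `V_j`, so the local edge and the
global arrow agree there. -/
theorem edge_smul (hx : x ∈ vertexSpace lam ν V j) (a : DoubleEdge I) (l : Fin n) :
    toAlg lam ν (.edge a l j) • x = arrow lam ν a l • x := by
  rw [mem_vertexSpace] at hx
  rw [← arrow_mul_idem, mul_smul, hx]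

theorem arrow_smul_mem (hx : x ∈ vertexSpace lam ν V j) (a : DoubleEdge I) (l : Fin n) :
    arrow lam ν a l • x ∈ vertexSpace lam ν V (moveTuple a l j) := by
  rw [← edge_smul hx, mem_vertexSpace, smul_smul, idem_mul_edge]

theorem arrow_smul_eq_zero (hx : x ∈ vertexSpace lam ν V j) {a : DoubleEdge I} {l : Fin n}
    (h : j l ≠ tail a) : arrow lam ν a l • x = 0 := by
  rw [← edge_smul hx, edge_eq_zero _ _ h, zero_smul]

theorem perm_smul_mem (hx : x ∈ vertexSpace lam ν V j) (σ : Equiv.Perm (Fin n)) :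
    toAlg lam ν (.perm σ) • x ∈ vertexSpace lam ν V (permTuple σ j) := by
  rw [mem_vertexSpace] at hx ⊢
  rw [smul_smul, ← perm_mul_idem, mul_smul, hx]

theorem arrow_smul_comm {l m : Fin n} (hlm : l ≠ m) {a b : DoubleEdge I} (h : a ≠ star b)
    (x : V) : arrow lam ν a l • arrow lam ν b m • x = arrow lam ν b m • arrow lam ν a l • x := by
  rw [smul_smul, smul_smul, arrow_mul_comm _ _ hlm h]

variable [Module k V] [IsScalarTower k (WreathAlg n lam ν) V]

/-- The one situation in which arrows in different slots fail to commute; every later transposition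
term coming from relation (ii) originates here. -/
theorem arrow_smul_reverse (hx : x ∈ vertexSpace lam ν V j) {l m : Fin n} (hlm : l ≠ m)
    (a : Quiver.Total.{w, uI} I) (hl : j l = a.left) (hm : j m = a.right) :
    arrow lam ν (Sum.inl a) l • arrow lam ν (Sum.inr a) m • x
      = arrow lam ν (Sum.inr a) m • arrow lam ν (Sum.inl a) l • x
        - ν • toAlg lam ν (.perm (Equiv.swap l m)) • x := by
  have h := two_slot_relation lam ν hlm (Sum.inl a) (Sum.inr a) j hl hm
  rw [if_neg (by simp), if_pos (by simp [star])] at h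
  have h2 := congrArg (· • x) h
  simp only [wreathAlg_sub_smul, wreathAlg_neg_smul, mul_smul, smul_assoc, edge_smul hx,
    edge_smul (arrow_smul_mem hx _ _), (mem_vertexSpace lam ν).1 hx] at h2
  rw [sub_eq_iff_eq_add] at h2
  rw [h2]
  abel

theorem sum_commutator_smul (hx : x ∈ vertexSpace lam ν V j) (l : Fin n) :
    ∑ a : Quiver.Total.{w, uI} I,
        (arrow lam ν (Sum.inl a) l • arrow lam ν (Sum.inr a) l • x
          - arrow lam ν (Sum.inr a) l • arrow lam ν (Sum.inl a) l • x)
      = lam (j l) • x + ν • ∑ m : Fin n with m ≠ l ∧ j m = j l,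
        toAlg lam ν (.perm (Equiv.swap l m)) • x := by
  have h2 := congrArg (· • x) (commutator_relation lam ν l j)
  simp only [wreathAlg_sub_smul, Finset.sum_smul, mul_smul, smul_assoc, edge_smul hx,
    edge_smul (arrow_smul_mem hx _ _), (mem_vertexSpace lam ν).1 hx] at h2
  rw [← h2]
  abel

end VertexSpaces

end AlgebraRelations

/-! ### Slot combinatorics: extending, restricting and permuting partial maps, and the effect on
`t(j, ξ)`. -/

section PartialMaps

variable {I : Type uI} [Quiver.{w} I] {n : ℕ} {i : I}

theorem mem_dom {ξ : PartialMap n i} {m : Fin n} : m ∈ dom ξ ↔ ξ m ≠ none := by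
  simp [dom, Option.isSome_iff_ne_none]

theorem dom_restr (p : Fin n) (ξ : PartialMap n i) : dom (restr p ξ) = (dom ξ).erase p := by
  ext m
  by_cases h : m = p <;> simp [mem_dom, restr, h]

theorem dom_extend (r : EdgesInto i) (p : Fin n) (ξ : PartialMap n i) :
    dom (extend r p ξ) = insert p (dom ξ) := by
  ext m
  by_cases h : m = p <;> simp [mem_dom, extend, h]

theorem extend_apply_self (r : EdgesInto i) (p : Fin n) (ξ : PartialMap n i) :
    extend r p ξ p = some r := by simp [extend]

theorem extend_apply_ne (r : EdgesInto i) {p q : Fin n} (h : q ≠ p) (ξ : PartialMap n i) :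
    extend r p ξ q = ξ q := by simp [extend, h]

theorem restr_apply_self (p : Fin n) (ξ : PartialMap n i) : restr p ξ p = none := by simp [restr]

theorem restr_apply_ne {p q : Fin n} (h : q ≠ p) (ξ : PartialMap n i) :
    restr p ξ q = ξ q := by simp [restr, h]

theorem extend_restr_of_eq {r : EdgesInto i} {p : Fin n} {ξ : PartialMap n i}
    (h : ξ p = some r) : extend r p (restr p ξ) = ξ := by
  simp [extend, restr, ← h]

theorem restr_extend_of_eq {p : Fin n} {ξ : PartialMap n i}
    (h : ξ p = none) (r : EdgesInto i) : restr p (extend r p ξ) = ξ := by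
  simp [extend, restr, ← h]

theorem extend_comm (r r' : EdgesInto i) {p q : Fin n} (h : p ≠ q) (ξ : PartialMap n i) :
    extend r p (extend r' q ξ) = extend r' q (extend r p ξ) :=
  Function.update_comm h.symm _ _ _

theorem restr_comm {p q : Fin n} (h : p ≠ q) (ξ : PartialMap n i) :
    restr p (restr q ξ) = restr q (restr p ξ) :=
  Function.update_comm h.symm _ _ _

theorem restr_extend_comm (r : EdgesInto i) {p q : Fin n} (h : p ≠ q) (ξ : PartialMap n i) :
    restr p (extend r q ξ) = extend r q (restr p ξ) :=
  Function.update_comm h.symm _ _ _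

theorem restr_comp_perm (σ : Equiv.Perm (Fin n)) (p : Fin n) (ξ : PartialMap n i) :
    (fun m => restr (σ p) ξ (σ m)) = restr p (fun m => ξ (σ m)) := by
  funext m
  by_cases h : m = p <;> simp [restr, h]

theorem extend_comp_perm (σ : Equiv.Perm (Fin n)) (r : EdgesInto i) (p : Fin n)
    (ξ : PartialMap n i) :
    (fun m => extend r (σ p) ξ (σ m)) = extend r p (fun m => ξ (σ m)) := by
  funext m
  by_cases h : m = p <;> simp [extend, h]

theorem tailTuple_of_none {j : Fin n → I} {ξ : PartialMap n i} {m : Fin n} (h : ξ m = none) :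
    tailTuple j ξ m = j m := by simp [tailTuple, h]

theorem tailTuple_of_some {j : Fin n → I} {ξ : PartialMap n i} {m : Fin n} {r : EdgesInto i}
    (h : ξ m = some r) : tailTuple j ξ m = r.1.left := by simp [tailTuple, h]

theorem tailTuple_update_of_some {j : Fin n → I} {ξ : PartialMap n i} {l : Fin n}
    {r : EdgesInto i} (h : ξ l = some r) (hj : j l = r.1.left) (c : I) :
    tailTuple (Function.update j l c) ξ = tailTuple j (restr l ξ) := by
  funext m
  by_cases hm : m = l
  · subst hm
    simp [tailTuple, restr, h, hj]
  · simp [tailTuple, restr, hm]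

theorem tailTuple_extend {j : Fin n → I} {ξ : PartialMap n i} {l : Fin n}
    (h : ξ l = none) (r : EdgesInto i) :
    tailTuple j (extend r l ξ) = tailTuple (Function.update j l r.1.left) ξ := by
  funext m
  by_cases hm : m = l
  · subst hm
    simp [tailTuple, extend, h]
  · simp [tailTuple, extend, hm]

theorem moveTuple_inr_tailTuple [DecidableEq I] {j : Fin n → I} {ξ : PartialMap n i} {l : Fin n}
    {r : EdgesInto i} (h : ξ l = some r) :
    moveTuple (Sum.inr r.1) l (tailTuple j (restr l ξ)) = tailTuple j ξ := by
  funext m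
  by_cases hm : m = l
  · subst hm
    simp [tailTuple, moveTuple, head, h]
  · simp [tailTuple, moveTuple, restr, hm]

theorem moveTuple_inl_tailTuple [DecidableEq I] {j : Fin n → I} {ξ : PartialMap n i} {l : Fin n}
    (r : EdgesInto i) (hj : j l = i) (h : ξ l = none) :
    moveTuple (Sum.inl r.1) l (tailTuple j (extend r l ξ)) = tailTuple j ξ := by
  funext m
  by_cases hm : m = l
  · subst hm
    simp [tailTuple, moveTuple, head, h, hj, r.2]
  · simp [tailTuple, moveTuple, extend, hm]

theorem moveTuple_tailTuple [DecidableEq I] {j : Fin n → I} {ξ : PartialMap n i} {l : Fin n}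
    (h : ξ l = none) (a : DoubleEdge I) :
    moveTuple a l (tailTuple j ξ) = tailTuple (moveTuple a l j) ξ := by
  funext m
  by_cases hm : m = l
  · subst hm
    simp [tailTuple, moveTuple, h]
  · simp [tailTuple, moveTuple, hm]

theorem permTuple_tailTuple (σ : Equiv.Perm (Fin n)) (j : Fin n → I) (ξ : PartialMap n i) :
    permTuple σ (tailTuple j (fun m => ξ (σ m))) = tailTuple (permTuple σ j) ξ := by
  funext m
  simp [tailTuple, permTuple]

end PartialMaps

/-! ### Tuple-free operators on all families, and their agreement with those of the construction. -/

section Operators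

variable {k : Type uk} [CommRing k] {I : Type uI} [Fintype I] [DecidableEq I]
  [Quiver.{w} I] [Fintype (Quiver.Total.{w, uI} I)]
  [DecidableEq (Quiver.Total.{w, uI} I)] {n : ℕ} {lam : I → k} {ν : k} {i : I}
  {V : Type v} [AddCommGroup V]

variable (k) in
/-- On the slot `p`, the operator that turns the value `none` into `r`. -/
def raise [Module k V] (r : EdgesInto i) (p : Fin n) :
    Amb (n := n) i V →ₗ[k] Amb (n := n) i V where
  toFun x ξ := if ξ p = some r then x (restr p ξ) else 0
  map_add' x y := by funext ξ; by_cases h : ξ p = some r <;> simp [h]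
  map_smul' c x := by funext ξ; by_cases h : ξ p = some r <;> simp [h]

variable (k) in
/-- On the slot `p`, the operator that turns the value `r` into `none`. -/
def lower [Module k V] (r : EdgesInto i) (p : Fin n) :
    Amb (n := n) i V →ₗ[k] Amb (n := n) i V where
  toFun x ξ := if ξ p = none then x (extend r p ξ) else 0
  map_add' x y := by funext ξ; by_cases h : ξ p = none <;> simp [h]
  map_smul' c x := by funext ξ; by_cases h : ξ p = none <;> simp [h]

theorem raise_apply [Module k V] (r : EdgesInto i) (p : Fin n) (x : Amb (n := n) i V)
    (ξ : PartialMap n i) :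
    raise k r p x ξ = if ξ p = some r then x (restr p ξ) else 0 := rfl

theorem lower_apply [Module k V] (r : EdgesInto i) (p : Fin n) (x : Amb (n := n) i V)
    (ξ : PartialMap n i) :
    lower k r p x ξ = if ξ p = none then x (extend r p ξ) else 0 := rfl

variable [Module (WreathAlg n lam ν) V] [Module k V] [IsScalarTower k (WreathAlg n lam ν) V]

variable (lam ν) in
/-- `σ` acting simultaneously on the slots and on `V`. -/
def permAct (σ : Equiv.Perm (Fin n)) : Amb (n := n) i V →ₗ[k] Amb (n := n) i V where
  toFun x ξ := toAlg lam ν (.perm σ) • x (fun m => ξ (σ m))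
  map_add' x y := by funext ξ; simp
  map_smul' c x := by
    funext ξ
    exact smul_comm (toAlg lam ν (.perm σ)) c (x fun m => ξ (σ m))

variable (lam ν) in
/-- The operator `∑_r π_r r_p`, summed over the edges `r` into `i`. -/
def contract (p : Fin n) : Amb (n := n) i V →ₗ[k] Amb (n := n) i V :=
  ∑ r : EdgesInto i, lower k r p ∘ₗ Algebra.lsmul k k _ (arrow lam ν (Sum.inl r.1) p)

variable (lam ν) in
/-- The operator `∑_r μ_r r*_p`, summed over the edges `r` into `i`. -/
def expand (p : Fin n) : Amb (n := n) i V →ₗ[k] Amb (n := n) i V :=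
  ∑ r : EdgesInto i, raise k r p ∘ₗ Algebra.lsmul k k _ (arrow lam ν (Sum.inr r.1) p)

variable (x : Amb (n := n) i V)

theorem raise_smul (r : EdgesInto i) (p : Fin n) (a : WreathAlg n lam ν) :
    raise k r p (a • x) = a • raise k r p x := by
  funext ξ
  by_cases h : ξ p = some r <;> simp [raise_apply, h]

theorem lower_smul (r : EdgesInto i) (p : Fin n) (a : WreathAlg n lam ν) :
    lower k r p (a • x) = a • lower k r p x := by
  funext ξ
  by_cases h : ξ p = none <;> simp [lower_apply, h]

theorem permAct_apply (σ : Equiv.Perm (Fin n)) (ξ : PartialMap n i) :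
    permAct lam ν σ x ξ = toAlg lam ν (.perm σ) • x (fun m => ξ (σ m)) := rfl

theorem contract_eq_sum (p : Fin n) : contract lam ν p x =
    ∑ r : EdgesInto i, lower k r p (arrow lam ν (Sum.inl r.1) p • x) := by
  simp [contract]

theorem expand_eq_sum (p : Fin n) : expand lam ν p x =
    ∑ r : EdgesInto i, raise k r p (arrow lam ν (Sum.inr r.1) p • x) := by
  simp [expand]

theorem contract_apply (p : Fin n) (ξ : PartialMap n i) : contract lam ν p x ξ =
    if ξ p = none then ∑ r : EdgesInto i, arrow lam ν (Sum.inl r.1) p • x (extend r p ξ) else 0 := by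
  by_cases h : ξ p = none <;> simp [contract_eq_sum, lower_apply, h]

theorem contract_apply_of_none {p : Fin n} {ξ : PartialMap n i} (h : ξ p = none) :
    contract lam ν p x ξ =
      ∑ r : EdgesInto i, arrow lam ν (Sum.inl r.1) p • x (extend r p ξ) := by
  rw [contract_apply, if_pos h]

theorem contract_apply_of_ne {p : Fin n} {ξ : PartialMap n i} (h : ξ p ≠ none) :
    contract lam ν p x ξ = 0 := by
  rw [contract_apply, if_neg h]

theorem expand_apply_of_some {p : Fin n} {ξ : PartialMap n i} {r : EdgesInto i}
    (h : ξ p = some r) :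
    expand lam ν p x ξ = arrow lam ν (Sum.inr r.1) p • x (restr p ξ) := by
  rw [expand_eq_sum, Finset.sum_apply, Finset.sum_eq_single r]
  · simp [raise_apply, h]
  · intro r' _ hr
    simp [raise_apply, h, hr.symm]
  · simp

theorem expand_apply_of_none {p : Fin n} {ξ : PartialMap n i} (h : ξ p = none) :
    expand lam ν p x ξ = 0 := by
  simp [expand_eq_sum, raise_apply, h]

/-! ### Membership in the spaces `V(j, D)` -/

theorem apply_mem {x : Amb (n := n) i V} {j : Fin n → I} {D : Finset (Fin n)}
    (hx : x ∈ sumSpace lam ν i V j D) (ξ : PartialMap n i) :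
    x ξ ∈ vertexSpace lam ν V (tailTuple j ξ) := by
  rw [mem_sumSpace] at hx
  by_cases h : dom ξ = D
  · exact (hx ξ).1 h
  · rw [(hx ξ).2 h]
    exact zero_mem _

theorem apply_eq_zero {x : Amb (n := n) i V} {j : Fin n → I} {D : Finset (Fin n)}
    (hx : x ∈ sumSpace lam ν i V j D) {ξ : PartialMap n i} (h : dom ξ ≠ D) : x ξ = 0 :=
  (((mem_sumSpace lam ν i j D x).1 hx) ξ).2 h

theorem mem_sumSpace_of {x : Amb (n := n) i V} {j : Fin n → I} {D : Finset (Fin n)}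
    (h1 : ∀ ξ, x ξ ∈ vertexSpace lam ν V (tailTuple j ξ)) (h2 : ∀ ξ, x ξ ≠ 0 → dom ξ = D) :
    x ∈ sumSpace lam ν i V j D :=
  (mem_sumSpace lam ν i j D x).2 fun ξ => ⟨fun _ => h1 ξ, fun h => by
    by_contra h0
    exact h (h2 ξ h0)⟩

theorem dom_of_ne_zero {x : Amb (n := n) i V} {j : Fin n → I} {D : Finset (Fin n)}
    (hx : x ∈ sumSpace lam ν i V j D) {ξ : PartialMap n i} (h : x ξ ≠ 0) : dom ξ = D := by
  by_contra h'
  exact h (apply_eq_zero hx h')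

theorem block_apply (η ξ ζ : PartialMap n i) (c : WreathAlg n lam ν) (x : Amb (n := n) i V) :
    block lam ν η ξ c x ζ = if ζ = η then c • x ξ else 0 := by
  change Pi.single (M := fun _ => V) η (c • x ξ) ζ = _
  rw [Pi.single_apply]

theorem mem_mapsOn {D : Finset (Fin n)} {ξ : PartialMap n i} : ξ ∈ mapsOn i D ↔ dom ξ = D := by
  simp [mapsOn]

variable {x} {j : Fin n → I} {D : Finset (Fin n)}

theorem smul_mem_sumSpace (hx : x ∈ sumSpace lam ν i V j D) (c : k) :
    c • x ∈ sumSpace lam ν i V j D := by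
  refine mem_sumSpace_of (fun ξ => ?_) (fun ξ h => dom_of_ne_zero hx (ξ := ξ) ?_)
  · have := apply_mem hx ξ
    rw [mem_vertexSpace] at this ⊢
    rw [Pi.smul_apply, smul_comm, this]
  · rintro h0
    simp [h0] at h

/-- The new entry `c` is arbitrary: slot `l` is filled on the support of the result, so `t(j, ξ)`
reads the tail of `r` there and never `c`. -/
theorem raise_mem (hx : x ∈ sumSpace lam ν i V j D) {r : EdgesInto i} {l : Fin n}
    (hj : j l = r.1.left) (c : I) :
    raise k r l x ∈ sumSpace lam ν i V (Function.update j l c) (insert l D) := by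
  refine mem_sumSpace_of (fun ξ => ?_) (fun ξ h => ?_)
  · rw [raise_apply]
    split_ifs with h
    · rw [tailTuple_update_of_some h hj]
      exact apply_mem hx _
    · exact zero_mem _
  · rw [raise_apply] at h
    have h1 : ξ l = some r := by
      by_contra h1
      exact h (if_neg h1)
    rw [if_pos h1] at h
    rw [← dom_of_ne_zero hx h, dom_restr, Finset.insert_erase]
    simp [mem_dom, h1]

theorem lower_mem (hx : x ∈ sumSpace lam ν i V j D) (r : EdgesInto i) (l : Fin n) :
    lower k r l x ∈ sumSpace lam ν i V (Function.update j l r.1.left) (D.erase l) := by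
  refine mem_sumSpace_of (fun ξ => ?_) (fun ξ h => ?_)
  · rw [lower_apply]
    split_ifs with h
    · rw [← tailTuple_extend h]
      exact apply_mem hx _
    · exact zero_mem _
  · rw [lower_apply] at h
    have h1 : ξ l = none := by
      by_contra h1
      exact h (if_neg h1)
    rw [if_pos h1] at h
    rw [← dom_of_ne_zero hx h, dom_extend, Finset.erase_insert]
    simp [mem_dom, h1]

theorem contract_mem (hx : x ∈ sumSpace lam ν i V j D) {l : Fin n} (hj : j l = i) :
    contract lam ν l x ∈ sumSpace lam ν i V j (D.erase l) := by
  refine mem_sumSpace_of (fun ξ => ?_) (fun ξ h => ?_)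
  · rw [contract_apply]
    split_ifs with h
    · refine sum_mem fun r _ => ?_
      rw [← moveTuple_inl_tailTuple r hj h]
      exact arrow_smul_mem (apply_mem hx _) _ _
    · exact zero_mem _
  · rw [contract_apply] at h
    have h1 : ξ l = none := by
      by_contra h1
      exact h (if_neg h1)
    rw [if_pos h1] at h
    obtain ⟨r, -, hr⟩ := Finset.exists_ne_zero_of_sum_ne_zero h
    have hr' : x (extend r l ξ) ≠ 0 := fun h0 => hr (by rw [h0, smul_zero])
    rw [← dom_of_ne_zero hx hr', dom_extend, Finset.erase_insert]
    simp [mem_dom, h1]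

theorem expand_mem (hx : x ∈ sumSpace lam ν i V j D) (l : Fin n) :
    expand lam ν l x ∈ sumSpace lam ν i V j (insert l D) := by
  refine mem_sumSpace_of (fun ξ => ?_) (fun ξ h => ?_)
  · cases h : ξ l with
    | none => rw [expand_apply_of_none _ h]; exact zero_mem _
    | some r =>
      rw [expand_apply_of_some _ h, ← moveTuple_inr_tailTuple h]
      exact arrow_smul_mem (apply_mem hx _) _ _
  · cases h1 : ξ l with
    | none => exact absurd (expand_apply_of_none _ h1) h
    | some r =>
      rw [expand_apply_of_some _ h1] at h
      have hr' : x (restr l ξ) ≠ 0 := fun h0 => h (by rw [h0, smul_zero])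
      rw [← dom_of_ne_zero hx hr', dom_restr, Finset.insert_erase]
      simp [mem_dom, h1]

theorem permAct_mem (hx : x ∈ sumSpace lam ν i V j D) (σ : Equiv.Perm (Fin n)) {D' : Finset (Fin n)}
    (hD : ∀ m, σ m ∈ D' ↔ m ∈ D) :
    permAct lam ν σ x ∈ sumSpace lam ν i V (permTuple σ j) D' := by
  refine mem_sumSpace_of (fun ξ => ?_) (fun ξ h => ?_)
  · rw [permAct_apply, ← permTuple_tailTuple]
    exact perm_smul_mem (apply_mem hx _) σ
  · have hr' : x (fun m => ξ (σ m)) ≠ 0 := fun h0 => h (by rw [permAct_apply, h0, smul_zero])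
    have h2 := dom_of_ne_zero hx hr'
    ext m
    obtain ⟨m, rfl⟩ := σ.surjective m
    rw [hD, ← h2, mem_dom, mem_dom]

/-- The slot must be empty: at a slot in `D` the entry of `t(j, ξ)` comes from `ξ`, and moving `j`
would not record the new vertex. -/
theorem arrow_smul_mem_sumSpace (hx : x ∈ sumSpace lam ν i V j D) (a : DoubleEdge I)
    {l : Fin n} (hl : l ∉ D) :
    arrow lam ν a l • x ∈ sumSpace lam ν i V (moveTuple a l j) D := by
  have key : ∀ ξ, x ξ ≠ 0 → ξ l = none := fun ξ h => by
    rw [← dom_of_ne_zero hx h, mem_dom, not_not] at hl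
    exact hl
  refine mem_sumSpace_of (fun ξ => ?_) (fun ξ h => dom_of_ne_zero hx (ξ := ξ) ?_)
  · by_cases h : x ξ = 0
    · rw [Pi.smul_apply, h, smul_zero]; exact zero_mem _
    · rw [← moveTuple_tailTuple (key ξ h)]
      exact arrow_smul_mem (apply_mem hx _) _ _
  · intro h0
    rw [Pi.smul_apply, h0, smul_zero] at h
    exact h rfl

/-! ### Comparison with the operators of the construction -/

/-- Families in `V(j, D)` vanish off `𝒳(D)`, so the sum may run over all partial maps; the terms
landing at `η` are then indexed by the edges `r` that can be restored in slot `p`. -/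
theorem piOp_eq (hx : x ∈ sumSpace lam ν i V j D) (p : Fin n) :
    piOp lam ν i V j D p x = contract lam ν p x := by
  funext η
  rw [piOp, AddMonoidHom.finsetSum_apply, Finset.sum_apply,
    Finset.sum_subset (Finset.subset_univ _)]
  · by_cases hη : η p = none
    · rw [contract_apply_of_none _ hη]
      symm
      -- The fibre of `ρ_p` over `η`, among maps defined at `p`, is parametrized by the value at
      -- `p`.
      refine Finset.sum_of_injOn (fun r => extend r p η) ?_ ?_ ?_ ?_
      · intro r _ r' _ h
        have := congrFun h p
        simpa [extend] using this
      · intro _ _; simp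
      · intro ξ _ h
        cases h1 : ξ p with
        | none => rfl
        | some r =>
          rw [Option.elim_some, block_apply, if_neg]
          rintro rfl
          exact h ⟨r, by simp, extend_restr_of_eq h1⟩
      · intro r _
        simp only [extend_apply_self, Option.elim_some]
        rw [block_apply, if_pos (restr_extend_of_eq hη r).symm, edge_smul (apply_mem hx _)]
    · rw [contract_apply_of_ne _ hη]
      refine Finset.sum_eq_zero fun ξ _ => ?_
      cases h1 : ξ p with
      | none => rfl
      | some r =>
        rw [Option.elim_some, block_apply, if_neg]
        rintro rfl
        exact hη (restr_apply_self _ _)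
  · intro ξ _ h
    rw [mem_mapsOn] at h
    cases h1 : ξ p with
    | none => rfl
    | some r => rw [Option.elim_some, block_apply, apply_eq_zero hx h, smul_zero, ite_self]

theorem muOp_eq (hx : x ∈ sumSpace lam ν i V j D) (p : Fin n) :
    muOp lam ν i V j (insert p D) p x = expand lam ν p x := by
  funext ξ
  rw [muOp, AddMonoidHom.finsetSum_apply, Finset.sum_apply, Finset.sum_eq_single ξ]
  · cases h1 : ξ p with
    | none => rw [expand_apply_of_none _ h1]; rfl
    | some r =>
      rw [Option.elim_some, block_apply, if_pos rfl, expand_apply_of_some _ h1,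
        edge_smul (apply_mem hx _)]
  · intro η _ hη
    cases h1 : η p with
    | none => rfl
    | some r => rw [Option.elim_some, block_apply, if_neg hη.symm]
  · intro h
    rw [mem_mapsOn] at h
    cases h1 : ξ p with
    | none => rfl
    | some r =>
      rw [Option.elim_some, block_apply, if_pos rfl, apply_eq_zero hx, smul_zero]
      intro h2
      rw [← h2, dom_restr, Finset.insert_erase] at h
      · exact h rfl
      · simp [mem_dom, h1]

theorem permOp_eq (hx : x ∈ sumSpace lam ν i V j D) (σ : Equiv.Perm (Fin n)) :
    permOp lam ν i V D σ x = permAct lam ν σ x := by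
  funext ξ
  rw [permOp, AddMonoidHom.finsetSum_apply, Finset.sum_apply,
    Finset.sum_eq_single (fun m => ξ (σ m))]
  · rw [block_apply, if_pos, permAct_apply]
    funext m
    simp [permMap]
  · intro η _ hη
    rw [block_apply, if_neg]
    rintro rfl
    exact hη (by funext m; simp [permMap])
  · intro h
    rw [mem_mapsOn] at h
    rw [block_apply, apply_eq_zero hx h, smul_zero, ite_self]

theorem edgeOp_eq (hx : x ∈ sumSpace lam ν i V j D) (a : DoubleEdge I) (l : Fin n) :
    edgeOp lam ν i V a l j D x = arrow lam ν a l • x := by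
  funext ξ
  rw [edgeOp, AddMonoidHom.finsetSum_apply, Finset.sum_apply, Finset.sum_eq_single ξ]
  · rw [block_apply, if_pos rfl, edge_smul (apply_mem hx _), Pi.smul_apply]
  · intro η _ hη
    rw [block_apply, if_neg hη.symm]
  · intro h
    rw [mem_mapsOn] at h
    rw [block_apply, apply_eq_zero hx h, smul_zero, ite_self]

theorem tauUpper_eq (hx : x ∈ sumSpace lam ν i V j D) (r : EdgesInto i) (l : Fin n) :
    tauUpper lam ν V r l D x = lower k r l x := by
  funext ξ
  rw [tauUpper, AddMonoidHom.finsetSum_apply, Finset.sum_apply, lower_apply]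
  split_ifs with h
  · rw [Finset.sum_eq_single ξ]
    · rw [block_apply, if_pos rfl, one_smul]
    · intro η _ hη
      rw [block_apply, if_neg hη.symm]
    · intro hξ
      rw [mem_mapsOn] at hξ
      rw [block_apply, apply_eq_zero hx, smul_zero, ite_self]
      rintro h2
      rw [← h2, dom_extend, Finset.erase_insert] at hξ
      · exact hξ rfl
      · simp [mem_dom, h]
  · refine Finset.sum_eq_zero fun η hη => ?_
    rw [block_apply, if_neg]
    rintro rfl
    rw [mem_mapsOn] at hη
    rw [← ne_eq, ← mem_dom, hη] at h
    simp at h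

theorem tauLower_eq (hx : x ∈ sumSpace lam ν i V j D) (r : EdgesInto i) {l : Fin n} (hl : l ∉ D) :
    tauLower lam ν V r l (insert l D) x = raise k r l x := by
  funext ξ
  rw [tauLower, AddMonoidHom.finsetSum_apply, Finset.sum_apply, Finset.erase_insert hl,
    Finset.sum_eq_single (restr l ξ)]
  · rw [block_apply, one_smul, raise_apply]
    refine if_congr ⟨fun h => ?_, fun h => (extend_restr_of_eq h).symm⟩ rfl rfl
    rw [h, extend_apply_self]
  · intro η hη hη'
    rw [block_apply, if_neg]
    rintro rfl
    refine hη' (restr_extend_of_eq ?_ r).symm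
    rw [mem_mapsOn] at hη
    rw [← hη, mem_dom, not_not] at hl
    exact hl
  · intro h
    rw [mem_mapsOn] at h
    rw [block_apply, apply_eq_zero hx h, smul_zero, ite_self]

end Operators

/-! ### Commutation rules for slot maps, permutations, contractions and expansions. -/

section Commutation

variable {k : Type uk} [CommRing k] {I : Type uI} [Fintype I] [DecidableEq I]
  [Quiver.{w} I] [Fintype (Quiver.Total.{w, uI} I)]
  [DecidableEq (Quiver.Total.{w, uI} I)] {n : ℕ} {lam : I → k} {ν : k} {i : I}
  {V : Type v} [AddCommGroup V]

section Slots

variable [Module k V] (x : Amb (n := n) i V) (r r' : EdgesInto i) {p q : Fin n}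

theorem raise_raise (h : p ≠ q) : raise k r p (raise k r' q x) = raise k r' q (raise k r p x) := by
  funext ξ
  simp only [raise_apply, restr_apply_ne h, restr_apply_ne h.symm, restr_comm h]
  split_ifs <;> rfl

theorem lower_lower (h : p ≠ q) : lower k r p (lower k r' q x) = lower k r' q (lower k r p x) := by
  funext ξ
  simp only [lower_apply, extend_apply_ne _ h, extend_apply_ne _ h.symm, extend_comm _ _ h]
  split_ifs <;> rfl

theorem lower_raise (h : p ≠ q) : lower k r p (raise k r' q x) = raise k r' q (lower k r p x) := by
  funext ξ
  simp only [lower_apply, raise_apply, extend_apply_ne _ h.symm, restr_apply_ne h,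
    restr_extend_comm _ h.symm]
  split_ifs <;> rfl

/-- The support condition is needed because `lower` discards every component whose slot `p` is
filled. -/
theorem lower_raise_self (hx : ∀ ξ, x ξ ≠ 0 → ξ p = none) :
    lower k r p (raise k r' p x) = if r = r' then x else 0 := by
  funext ξ
  simp only [lower_apply, raise_apply, extend_apply_self, Option.some.injEq]
  by_cases h : ξ p = none
  · rw [if_pos h, restr_extend_of_eq h]
    split_ifs <;> rfl
  · rw [if_neg h]
    have : x ξ = 0 := by
      by_contra h'
      exact h (hx ξ h')
    split_ifs <;> simp [this]

theorem sum_raise_lower (hx : ∀ ξ, x ξ ≠ 0 → ξ p ≠ none) :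
    ∑ r : EdgesInto i, raise k r p (lower k r p x) = x := by
  funext ξ
  simp only [Finset.sum_apply, raise_apply, lower_apply, restr_apply_self, if_true]
  cases h : ξ p with
  | none =>
    have : x ξ = 0 := by
      by_contra h'
      exact hx ξ h' h
    simp [this]
  | some r =>
    rw [Finset.sum_eq_single r]
    · rw [if_pos rfl, extend_restr_of_eq h]
    · intro b _ hb
      rw [if_neg]
      simpa using hb.symm
    · simp

end Slots

variable [Module (WreathAlg n lam ν) V] [Module k V] [IsScalarTower k (WreathAlg n lam ν) V]

section Permutations

variable (x : Amb (n := n) i V) (σ τ : Equiv.Perm (Fin n)) (p : Fin n)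

theorem permAct_one : permAct lam ν 1 x = x := by
  funext ξ
  simp [permAct_apply, perm_one]

theorem permAct_mul : permAct lam ν (σ * τ) x = permAct lam ν σ (permAct lam ν τ x) := by
  funext ξ
  simp [permAct_apply, perm_mul, mul_smul]

theorem permAct_raise (r : EdgesInto i) :
    permAct lam ν σ (raise k r p x) = raise k r (σ p) (permAct lam ν σ x) := by
  funext ξ
  simp only [permAct_apply, raise_apply, restr_comp_perm]
  split_ifs <;> simp

theorem permAct_lower (r : EdgesInto i) :
    permAct lam ν σ (lower k r p x) = lower k r (σ p) (permAct lam ν σ x) := by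
  funext ξ
  simp only [permAct_apply, lower_apply, extend_comp_perm]
  split_ifs <;> simp

theorem permAct_arrow_smul (a : DoubleEdge I) :
    permAct lam ν σ (arrow lam ν a p • x) = arrow lam ν a (σ p) • permAct lam ν σ x := by
  funext ξ
  simp only [permAct_apply, Pi.smul_apply, smul_smul, perm_mul_arrow]

theorem permAct_contract :
    permAct lam ν σ (contract lam ν p x) = contract lam ν (σ p) (permAct lam ν σ x) := by
  simp only [contract_eq_sum, map_sum, permAct_lower, permAct_arrow_smul]

theorem permAct_expand :
    permAct lam ν σ (expand lam ν p x) = expand lam ν (σ p) (permAct lam ν σ x) := by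
  simp only [expand_eq_sum, map_sum, permAct_raise, permAct_arrow_smul]

end Permutations

section Contractions

variable (x : Amb (n := n) i V) {p q : Fin n}

theorem contract_lower (h : p ≠ q) (r : EdgesInto i) :
    contract lam ν p (lower k r q x) = lower k r q (contract lam ν p x) := by
  simp only [contract_eq_sum, map_sum]
  refine Finset.sum_congr rfl fun r' _ => ?_
  rw [← lower_smul, lower_lower _ _ _ h]

theorem contract_raise (h : p ≠ q) (r : EdgesInto i) :
    contract lam ν p (raise k r q x) = raise k r q (contract lam ν p x) := by
  simp only [contract_eq_sum, map_sum]
  refine Finset.sum_congr rfl fun r' _ => ?_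
  rw [← raise_smul, lower_raise _ _ _ h]

theorem expand_lower (h : p ≠ q) (r : EdgesInto i) :
    expand lam ν p (lower k r q x) = lower k r q (expand lam ν p x) := by
  simp only [expand_eq_sum, map_sum]
  refine Finset.sum_congr rfl fun r' _ => ?_
  rw [← lower_smul, lower_raise _ _ _ h.symm]

theorem expand_raise (h : p ≠ q) (r : EdgesInto i) :
    expand lam ν p (raise k r q x) = raise k r q (expand lam ν p x) := by
  simp only [expand_eq_sum, map_sum]
  refine Finset.sum_congr rfl fun r' _ => ?_
  rw [← raise_smul, raise_raise _ _ _ h]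

theorem arrow_smul_comm_amb (h : p ≠ q) {a b : DoubleEdge I} (hab : a ≠ star b) :
    arrow lam ν a p • arrow lam ν b q • x = arrow lam ν b q • arrow lam ν a p • x := by
  funext ξ
  exact arrow_smul_comm h hab (x ξ)

/-- A contraction involves only edges `r` of `R`, so the only arrows obstructing commutation are
their reverses. -/
theorem contract_arrow_smul (h : p ≠ q) {a : DoubleEdge I}
    (ha : ∀ r : EdgesInto i, a ≠ Sum.inr r.1) :
    contract lam ν p (arrow lam ν a q • x) = arrow lam ν a q • contract lam ν p x := by
  simp only [contract_eq_sum, Finset.smul_sum]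
  refine Finset.sum_congr rfl fun r _ => ?_
  rw [← lower_smul, arrow_smul_comm_amb x h.symm (ha r)]

theorem expand_arrow_smul (h : p ≠ q) {a : DoubleEdge I}
    (ha : ∀ r : EdgesInto i, a ≠ Sum.inl r.1) :
    expand lam ν p (arrow lam ν a q • x) = arrow lam ν a q • expand lam ν p x := by
  simp only [expand_eq_sum, Finset.smul_sum]
  refine Finset.sum_congr rfl fun r _ => ?_
  rw [← raise_smul, arrow_smul_comm_amb x h.symm (ha r)]

theorem contract_contract (h : p ≠ q) :
    contract lam ν p (contract lam ν q x) = contract lam ν q (contract lam ν p x) := by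
  rw [contract_eq_sum x q, map_sum, contract_eq_sum _ q]
  refine Finset.sum_congr rfl fun r _ => ?_
  rw [contract_lower _ h, contract_arrow_smul _ h (fun r' => by simp)]

theorem expand_expand (h : p ≠ q) :
    expand lam ν p (expand lam ν q x) = expand lam ν q (expand lam ν p x) := by
  rw [expand_eq_sum x q, map_sum, expand_eq_sum _ q]
  refine Finset.sum_congr rfl fun r _ => ?_
  rw [expand_raise _ h, expand_arrow_smul _ h (fun r' => by simp)]

variable {x} {j : Fin n → I} {D : Finset (Fin n)}

/-- All pairs of values `(r, r')` commute except `r = r'`, where relation (ii) contributes `-ν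
s_{pq}` in `V`. The slot maps erase that value at `p` and write it at `q`, which is what `s_{pq}`
does to the slots, so the corrections assemble into the simultaneous action of the transposition. -/
theorem contract_expand (hx : x ∈ sumSpace lam ν i V j D) (hp : p ∈ D) (hq : q ∉ D) (hj : j q = i) :
    contract lam ν p (expand lam ν q x)
      = expand lam ν q (contract lam ν p x) - ν • permAct lam ν (Equiv.swap p q) x := by
  have hpq : p ≠ q := by rintro rfl; exact hq hp
  have hxp : ∀ ξ, ξ p = none → x ξ = 0 := fun ξ h => by
    by_contra h0
    rw [← dom_of_ne_zero hx h0, mem_dom] at hp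
    exact hp h
  have hxq : ∀ ξ, ξ q ≠ none → x ξ = 0 := fun ξ h => by
    by_contra h0
    rw [← dom_of_ne_zero hx h0, mem_dom] at hq
    exact hq h
  funext η
  rw [Pi.sub_apply, Pi.smul_apply, permAct_apply]
  by_cases hηp : η p = none
  · cases hηq : η q with
    | none =>
      rw [expand_apply_of_none _ hηq, contract_apply_of_none _ hηp, hxp]
      · simp only [smul_zero, sub_zero]
        refine Finset.sum_eq_zero fun r _ => ?_
        rw [expand_apply_of_none, smul_zero]
        rw [extend_apply_ne _ hpq.symm, hηq]
      · simpa using hηq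
    | some r' =>
      -- With `p` empty and `q` filled, the transposition just transports the value of `q` to `p`.
      have hswap : (fun m => η (Equiv.swap p q m)) = extend r' p (restr q η) := by
        funext m
        by_cases h1 : m = p
        · subst h1
          rw [Equiv.swap_apply_left, extend_apply_self, hηq]
        · by_cases h2 : m = q
          · subst h2
            rw [Equiv.swap_apply_right, extend_apply_ne _ h1, restr_apply_self, hηp]
          · rw [Equiv.swap_apply_of_ne_of_ne h1 h2, extend_apply_ne _ h1, restr_apply_ne h2]
      have hηp' : restr q η p = none := by rw [restr_apply_ne hpq, hηp]
      rw [hswap, expand_apply_of_some _ hηq, contract_apply_of_none _ hηp,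
        contract_apply_of_none _ hηp', Finset.smul_sum]
      have key : ∀ r : EdgesInto i,
          arrow lam ν (Sum.inl r.1) p • expand lam ν q x (extend r p η)
            = arrow lam ν (Sum.inr r'.1) q • arrow lam ν (Sum.inl r.1) p • x (extend r p (restr q η))
              - if r = r' then ν • toAlg lam ν (.perm (Equiv.swap p q)) •
                x (extend r p (restr q η)) else 0 := by
        intro r
        rw [expand_apply_of_some (r := r') _ (by rw [extend_apply_ne _ hpq.symm, hηq]),
          restr_extend_comm _ hpq.symm]
        split_ifs with h
        · subst h
          refine arrow_smul_reverse (apply_mem hx _) hpq r.1 ?_ ?_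
          · exact tailTuple_of_some (extend_apply_self _ _ _)
          · rw [tailTuple_of_none, hj, r.2]
            rw [extend_apply_ne _ hpq.symm, restr_apply_self]
        · rw [sub_zero, arrow_smul_comm hpq]
          intro h'
          simp only [star, Sum.swap_inr, Sum.inl.injEq] at h'
          exact h (Subtype.ext h')
      rw [Finset.sum_congr rfl fun r _ => key r, Finset.sum_sub_distrib, Finset.sum_ite_eq']
      simp
  -- If `p` is filled in `η`, the transposed partial map has `q` filled, where `x` vanishes because
  -- `q ∉ D`.
  · rw [contract_apply_of_ne _ hηp, hxq _ (by simpa using hηp)]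
    cases hηq : η q with
    | none => simp [expand_apply_of_none _ hηq]
    | some r' =>
      rw [expand_apply_of_some _ hηq, contract_apply_of_ne]
      · simp
      · rwa [restr_apply_ne hpq]

theorem sum_edgesInto {M : Type*} [AddCommMonoid M] (f : Quiver.Total.{w, uI} I → M)
    (hf : ∀ a, a.right ≠ i → f a = 0) : ∑ r : EdgesInto i, f r.1 = ∑ a, f a := by
  refine Finset.sum_of_injOn Subtype.val Subtype.val_injective.injOn (fun _ _ => by simp) ?_
    (fun _ _ => rfl)
  intro a _ ha
  refine hf a fun h => ha ⟨⟨a, h⟩, by simp, rfl⟩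

/-- The composite is `∑_r r_p r*_p`, the half of the commutator in relation (i) which survives at a
sink: the terms `a* a` die since no edge starts at `i`, and edges not ending at `i` have reverses
which do not start there. -/
theorem contract_expand_self (hi : ∀ a : Quiver.Total.{w, uI} I, a.left ≠ i)
    (hx : x ∈ sumSpace lam ν i V j D) (hj : j p = i) (hD : D = (Delta i j).erase p) :
    contract lam ν p (expand lam ν p x) = lam i • x := by
  funext η
  rw [Pi.smul_apply]
  by_cases h0 : x η = 0
  · by_cases h : η p = none
    · rw [contract_apply_of_none _ h, h0, smul_zero]
      refine Finset.sum_eq_zero fun r _ => ?_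
      rw [expand_apply_of_some _ (extend_apply_self _ _ _), restr_extend_of_eq h, h0, smul_zero,
        smul_zero]
    · rw [contract_apply_of_ne _ h, h0, smul_zero]
  · have hdom := dom_of_ne_zero hx h0
    have h : η p = none := by
      by_contra h
      rw [← ne_eq, ← mem_dom, hdom, hD] at h
      simp at h
    have ht : tailTuple j η p = i := by rw [tailTuple_of_none h, hj]
    have hs := sum_commutator_smul (apply_mem hx η) p
    -- The `ν`-sum is empty: every other slot at `i` lies in `D`, so `η` replaces its vertex by a
    -- tail, and no tail equals `i`.
    rw [ht, Finset.sum_eq_zero (s := Finset.filter _ _), smul_zero, add_zero] at hs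
    · rw [contract_apply_of_none _ h, ← hs]
      have : ∀ r : EdgesInto i,
          arrow lam ν (Sum.inl r.1) p • expand lam ν p x (extend r p η)
            = arrow lam ν (Sum.inl r.1) p • arrow lam ν (Sum.inr r.1) p • x η := fun r => by
        rw [expand_apply_of_some _ (extend_apply_self _ _ _), restr_extend_of_eq h]
      rw [Finset.sum_congr rfl fun r _ => this r,
        sum_edgesInto (fun a => arrow lam ν (Sum.inl a) p • arrow lam ν (Sum.inr a) p • x η)]
      · refine Finset.sum_congr rfl fun a _ => ?_
        rw [arrow_smul_eq_zero (a := Sum.inl a) (apply_mem hx η), smul_zero, sub_zero]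
        rw [ht]
        exact (hi a).symm
      · intro a ha
        rw [arrow_smul_eq_zero (a := Sum.inr a) (apply_mem hx η), smul_zero]
        rw [ht]
        exact ha.symm
    · intro m hm
      exfalso
      obtain ⟨hmp, hm⟩ := (Finset.mem_filter.1 hm).2
      cases hm' : η m with
      | none =>
        rw [tailTuple_of_none hm'] at hm
        have : m ∈ dom η := by
          rw [hdom, hD]
          simp [hmp, Delta, hm]
        exact mem_dom.1 this hm'
      | some r =>
        rw [tailTuple_of_some hm'] at hm
        exact hi _ hm

end Contractions

end Commutation

/-! ### The shift operator: commutation with other slots, commuting shifts, and landing in the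
kernels. -/

section Shift

variable {k : Type uk} [CommRing k] {I : Type uI} [Fintype I] [DecidableEq I]
  [Quiver.{w} I] [Fintype (Quiver.Total.{w, uI} I)]
  [DecidableEq (Quiver.Total.{w, uI} I)] {n : ℕ} {lam : I → k} {ν : k} {i : I}
  {V : Type v} [AddCommGroup V]

theorem mem_Delta {j : Fin n → I} {m : Fin n} : m ∈ Delta i j ↔ j m = i := by simp [Delta]

theorem Delta_update_self (j : Fin n → I) (l : Fin n) :
    Delta i (Function.update j l i) = insert l (Delta i j) := by
  ext m
  by_cases h : m = l <;> simp [mem_Delta, h]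

theorem Delta_update_of_ne (j : Fin n → I) (l : Fin n) {c : I} (hc : c ≠ i) :
    Delta i (Function.update j l c) = (Delta i j).erase l := by
  ext m
  by_cases h : m = l <;> simp [mem_Delta, h, hc]

variable [Module (WreathAlg n lam ν) V] [Module k V] [IsScalarTower k (WreathAlg n lam ν) V]

variable (lam ν) in
/-- The operator `-λ_i + μ_ℓ π_ℓ + ν ∑_{m ∈ D} s_{mℓ}`. -/
def shift (l : Fin n) (D : Finset (Fin n)) : Amb (n := n) i V →ₗ[k] Amb (n := n) i V :=
  -(lam i • LinearMap.id) + expand lam ν l ∘ₗ contract lam ν l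
    + ν • ∑ m ∈ D, permAct lam ν (Equiv.swap m l)

section

variable (x : Amb (n := n) i V)

theorem shift_apply (l : Fin n) (D : Finset (Fin n)) :
    shift lam ν l D x = -(lam i • x) + expand lam ν l (contract lam ν l x)
      + ν • ∑ m ∈ D, permAct lam ν (Equiv.swap m l) x := by
  simp [shift]

theorem permAct_shift (σ : Equiv.Perm (Fin n)) (l : Fin n) {D D' : Finset (Fin n)}
    (hD : ∀ m, σ m ∈ D' ↔ m ∈ D) :
    permAct lam ν σ (shift lam ν l D x) = shift lam ν (σ l) D' (permAct lam ν σ x) := by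
  simp only [shift_apply, map_add, map_neg, map_smul, map_sum, permAct_expand, permAct_contract]
  congr 2
  refine Finset.sum_bij (fun m _ => σ m) (fun m hm => (hD m).2 hm) (fun _ _ _ _ h => σ.injective h)
    (fun m hm => ⟨σ⁻¹ m, (hD _).1 (by simpa using hm), by simp⟩) fun m _ => ?_
  rw [← permAct_mul, ← permAct_mul, Equiv.mul_swap_eq_swap_mul]

/-- The transpositions in the shift fix slot `l`, as `l ≠ m` and `l ∉ D`; the same reason lets
`raise` and `lower` in slot `l` pass through below. -/
theorem shift_arrow_smul {l m : Fin n} (hlm : l ≠ m) {D : Finset (Fin n)} (hl : l ∉ D)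
    {a : DoubleEdge I} (ha : ∀ r : EdgesInto i, a ≠ Sum.inl r.1)
    (ha' : ∀ r : EdgesInto i, a ≠ Sum.inr r.1) :
    shift lam ν m D (arrow lam ν a l • x) = arrow lam ν a l • shift lam ν m D x := by
  simp only [shift_apply, smul_add, smul_neg, Finset.smul_sum, contract_arrow_smul x hlm.symm ha',
    expand_arrow_smul _ hlm.symm ha]
  rw [smul_comm (arrow lam ν a l) (lam i) x]
  congr 1
  refine Finset.sum_congr rfl fun p hp => ?_
  rw [permAct_arrow_smul, Equiv.swap_apply_of_ne_of_ne _ hlm, smul_comm]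
  rintro rfl
  exact hl hp

theorem shift_raise {l m : Fin n} (hlm : l ≠ m) {D : Finset (Fin n)} (hl : l ∉ D)
    (r : EdgesInto i) :
    shift lam ν m D (raise k r l x) = raise k r l (shift lam ν m D x) := by
  simp only [shift_apply, map_add, map_neg, map_smul, map_sum, contract_raise x hlm.symm,
    expand_raise _ hlm.symm]
  congr 2
  refine Finset.sum_congr rfl fun p hp => ?_
  rw [permAct_raise, Equiv.swap_apply_of_ne_of_ne _ hlm]
  rintro rfl
  exact hl hp

theorem shift_lower {l m : Fin n} (hlm : l ≠ m) {D : Finset (Fin n)} (hl : l ∉ D)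
    (r : EdgesInto i) :
    shift lam ν m D (lower k r l x) = lower k r l (shift lam ν m D x) := by
  simp only [shift_apply, map_add, map_neg, map_smul, map_sum, contract_lower x hlm.symm,
    expand_lower _ hlm.symm]
  congr 2
  refine Finset.sum_congr rfl fun p hp => ?_
  rw [permAct_lower, Equiv.swap_apply_of_ne_of_ne _ hlm]
  rintro rfl
  exact hl hp

theorem shift_insert {l m : Fin n} {D : Finset (Fin n)} (hl : l ∉ D) :
    shift lam ν m (insert l D) x
      = shift lam ν m D x + ν • permAct lam ν (Equiv.swap l m) x := by
  rw [shift_apply, shift_apply, Finset.sum_insert hl, smul_add]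
  abel

end

variable {x : Amb (n := n) i V} {j : Fin n → I} {D : Finset (Fin n)}

/-- Apply `contract_expand` to the inner pair in each product. The leading terms agree because
expansions commute with each other and so do contractions; only the two transposition corrections
remain. -/
theorem expand_contract_comm (hx : x ∈ sumSpace lam ν i V j D) {l m : Fin n} (hlm : l ≠ m)
    (hl : l ∈ D) (hm : m ∈ D) (hjl : j l = i) (hjm : j m = i) :
    expand lam ν l (contract lam ν l (expand lam ν m (contract lam ν m x)))
      - expand lam ν m (contract lam ν m (expand lam ν l (contract lam ν l x)))
    = ν • permAct lam ν (Equiv.swap m l) (expand lam ν l (contract lam ν l x))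
      - ν • permAct lam ν (Equiv.swap m l) (expand lam ν m (contract lam ν m x)) := by
  rw [contract_expand (contract_mem hx hjm) (Finset.mem_erase.2 ⟨hlm, hl⟩)
      (Finset.notMem_erase _ _) hjm,
    contract_expand (contract_mem hx hjl) (Finset.mem_erase.2 ⟨hlm.symm, hm⟩)
      (Finset.notMem_erase _ _) hjl, map_sub, map_sub, expand_expand _ hlm, contract_contract _ hlm,
    map_smul, map_smul, permAct_expand, permAct_expand, Equiv.swap_apply_right,
    Equiv.swap_apply_left, Equiv.swap_comm l m]
  abel

theorem permAct_swap_swap (x : Amb (n := n) i V) {l m p : Fin n} (hlm : l ≠ m) (hpm : p ≠ m) :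
    permAct lam ν (Equiv.swap p l) (permAct lam ν (Equiv.swap p m) x)
      = permAct lam ν (Equiv.swap m l) (permAct lam ν (Equiv.swap p l) x) := by
  rw [← permAct_mul, ← permAct_mul, Equiv.mul_swap_eq_swap_mul, Equiv.swap_apply_left,
    Equiv.swap_apply_of_ne_of_ne hpm.symm hlm.symm, Equiv.swap_comm l m]

theorem permAct_swap_comm (x : Amb (n := n) i V) {l m p q : Fin n} (hlm : l ≠ m) (hpm : p ≠ m)
    (hql : q ≠ l) (hpq : p ≠ q) :
    permAct lam ν (Equiv.swap p l) (permAct lam ν (Equiv.swap q m) x)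
      = permAct lam ν (Equiv.swap q m) (permAct lam ν (Equiv.swap p l) x) := by
  rw [← permAct_mul, ← permAct_mul, Equiv.mul_swap_eq_swap_mul,
    Equiv.swap_apply_of_ne_of_ne hpq.symm hql, Equiv.swap_apply_of_ne_of_ne hpm.symm hlm.symm]

/-- A Jucys–Murphy type identity: transpositions with `p ≠ q` are disjoint and commute, and for `p =
q` one has `s_{pl} s_{pm} = s_{ml} s_{pl}` together with its mirror image. -/
theorem sum_permAct_comm (x : Amb (n := n) i V) {l m : Fin n} (hlm : l ≠ m) (hl : l ∉ D)
    (hm : m ∉ D) :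
    ∑ p ∈ D, permAct lam ν (Equiv.swap p l) (∑ q ∈ D, permAct lam ν (Equiv.swap q m) x)
      - ∑ q ∈ D, permAct lam ν (Equiv.swap q m) (∑ p ∈ D, permAct lam ν (Equiv.swap p l) x)
    = permAct lam ν (Equiv.swap m l) (∑ p ∈ D, permAct lam ν (Equiv.swap p l) x)
      - permAct lam ν (Equiv.swap m l) (∑ p ∈ D, permAct lam ν (Equiv.swap p m) x) := by
  simp only [map_sum]
  rw [Finset.sum_comm (f := fun q p => permAct lam ν (Equiv.swap q m)
    (permAct lam ν (Equiv.swap p l) x)), ← Finset.sum_sub_distrib, ← Finset.sum_sub_distrib]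
  refine Finset.sum_congr rfl fun p hp => ?_
  have hpl : p ≠ l := by rintro rfl; exact hl hp
  have hpm : p ≠ m := by rintro rfl; exact hm hp
  rw [← Finset.sum_sub_distrib, Finset.sum_eq_single p, permAct_swap_swap x hlm hpm,
    permAct_swap_swap x hlm.symm hpl, Equiv.swap_comm l m]
  · intro q hq hqp
    have hql : q ≠ l := by rintro rfl; exact hl hq
    rw [permAct_swap_comm x hlm hpm hql hqp.symm, sub_self]
  · exact fun h => absurd hp h

theorem expand_contract_permAct (x : Amb (n := n) i V) {l m p : Fin n} (hlm : l ≠ m)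
    (hpl : p ≠ l) :
    expand lam ν l (contract lam ν l (permAct lam ν (Equiv.swap p m) x))
      = permAct lam ν (Equiv.swap p m) (expand lam ν l (contract lam ν l x)) := by
  rw [permAct_expand, permAct_contract, Equiv.swap_apply_of_ne_of_ne hpl.symm hlm]

/-- With `X_l = μ_l π_l + ν ∑_{p ∈ D} s_{pl}` the two preceding commutators combine to `[X_l, X_m] =
ν s_{ml} (X_l - X_m)`, as in a degenerate affine Hecke algebra. The asymmetric index sets, `insert m
D` outside and `D` inside, supply `ν s_{ml} (X_m - X_l)`, which cancels it. -/
theorem shift_shift {l m : Fin n} (hx : x ∈ sumSpace lam ν i V j (insert l (insert m D)))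
    (hlm : l ≠ m) (hl : l ∉ D) (hm : m ∉ D) (hjl : j l = i) (hjm : j m = i) :
    shift lam ν l (insert m D) (shift lam ν m D x)
      = shift lam ν m (insert l D) (shift lam ν l D x) := by
  have h1 := expand_contract_comm hx hlm (by simp) (by simp) hjl hjm
  have h2 := sum_permAct_comm (lam := lam) (ν := ν) x hlm hl hm
  have h3 : expand lam ν l (contract lam ν l (∑ p ∈ D, permAct lam ν (Equiv.swap p m) x))
      = ∑ p ∈ D, permAct lam ν (Equiv.swap p m) (expand lam ν l (contract lam ν l x)) := by
    simp only [map_sum]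
    exact Finset.sum_congr rfl fun p hp =>
      expand_contract_permAct x hlm (by rintro rfl; exact hl hp)
  have h4 : expand lam ν m (contract lam ν m (∑ p ∈ D, permAct lam ν (Equiv.swap p l) x))
      = ∑ p ∈ D, permAct lam ν (Equiv.swap p l) (expand lam ν m (contract lam ν m x)) := by
    simp only [map_sum]
    exact Finset.sum_congr rfl fun p hp =>
      expand_contract_permAct x hlm.symm (by rintro rfl; exact hm hp)
  rw [shift_insert _ hm, shift_insert _ hl, Equiv.swap_comm l m]
  simp only [shift_apply]
  simp only [map_add, map_neg, map_smul, Finset.sum_add_distrib, Finset.sum_neg_distrib,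
    ← Finset.smul_sum, h3, h4]
  -- The mixed terms already match through `h3` and `h4`. The square occurs because both
  -- transposition sums carry a factor `ν`.
  linear_combination (norm := module) h1 + (ν ^ 2) • h2

theorem mem_kerSpace_iff {x : Amb (n := n) i V} {j : Fin n → I} {D : Finset (Fin n)} :
    x ∈ kerSpace lam ν i V j D ↔
      x ∈ sumSpace lam ν i V j D ∧ ∀ p ∈ D, contract lam ν p x = 0 := by
  rw [mem_kerSpace]
  refine and_congr_right fun hx => forall₂_congr fun p _ => ?_
  rw [piOp_eq hx]

theorem lower_mem_kerSpace (hx : x ∈ kerSpace lam ν i V j D) (r : EdgesInto i) (l : Fin n) :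
    lower k r l x ∈ kerSpace lam ν i V (Function.update j l r.1.left) (D.erase l) := by
  rw [mem_kerSpace_iff] at hx ⊢
  refine ⟨lower_mem hx.1 r l, fun p hp => ?_⟩
  rw [contract_lower _ (Finset.ne_of_mem_erase hp), hx.2 p (Finset.mem_of_mem_erase hp), map_zero]

theorem arrow_smul_mem_kerSpace (hx : x ∈ kerSpace lam ν i V j D) {a : DoubleEdge I} {l : Fin n}
    (hl : l ∉ D) (ha : ∀ r : EdgesInto i, a ≠ Sum.inr r.1) :
    arrow lam ν a l • x ∈ kerSpace lam ν i V (moveTuple a l j) D := by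
  rw [mem_kerSpace_iff] at hx ⊢
  refine ⟨arrow_smul_mem_sumSpace hx.1 a hl, fun p hp => ?_⟩
  rw [contract_arrow_smul _ _ ha, hx.2 p hp, smul_zero]
  rintro rfl
  exact hl hp

theorem permAct_mem_kerSpace (hx : x ∈ kerSpace lam ν i V j D) (σ : Equiv.Perm (Fin n))
    {D' : Finset (Fin n)} (hD : ∀ m, σ m ∈ D' ↔ m ∈ D) :
    permAct lam ν σ x ∈ kerSpace lam ν i V (permTuple σ j) D' := by
  rw [mem_kerSpace_iff] at hx ⊢
  refine ⟨permAct_mem hx.1 σ hD, fun p hp => ?_⟩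
  obtain ⟨p, rfl⟩ := σ.surjective p
  rw [← permAct_contract, hx.2 p ((hD p).1 hp), map_zero]

theorem permAct_swap_mem (hx : x ∈ sumSpace lam ν i V j D) {l m : Fin n} (hl : l ∈ D) (hm : m ∈ D)
    (hj : j l = j m) : permAct lam ν (Equiv.swap m l) x ∈ sumSpace lam ν i V j D := by
  have hp : permTuple (Equiv.swap m l) j = j := by
    funext p
    simp only [permTuple, Equiv.swap_inv]
    rcases eq_or_ne p m with rfl | h1
    · rw [Equiv.swap_apply_left, hj]
    · rcases eq_or_ne p l with rfl | h2
      · rw [Equiv.swap_apply_right, hj]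
      · rw [Equiv.swap_apply_of_ne_of_ne h1 h2]
  have := permAct_mem hx (Equiv.swap m l) (D' := D) fun p => by
    rcases eq_or_ne p m with rfl | h1
    · simp [hl, hm]
    · rcases eq_or_ne p l with rfl | h2
      · simp [hl, hm]
      · rw [Equiv.swap_apply_of_ne_of_ne h1 h2]
  rwa [hp] at this

theorem shift_mem (hx : x ∈ sumSpace lam ν i V j D) {l : Fin n} (hl : l ∈ D) {D' : Finset (Fin n)}
    (hD' : D' ⊆ D) (hj : ∀ m ∈ D, j m = i) : shift lam ν l D' x ∈ sumSpace lam ν i V j D := by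
  rw [shift_apply]
  refine add_mem (add_mem (neg_mem (smul_mem_sumSpace hx _)) ?_)
    (smul_mem_sumSpace (sum_mem fun m hm => ?_) _)
  · have := expand_mem (contract_mem hx (hj l hl)) l
    rwa [Finset.insert_erase hl] at this
  · exact permAct_swap_mem hx hl (hD' hm) (by rw [hj l hl, hj m (hD' hm)])

/-- The shift corrects the plain inclusion so that the family is killed by every contraction: the
scalar repairs slot `l`, and the transpositions repair the slots already in `Δ(j)`. -/
theorem shift_raise_mem_kerSpace (hi : ∀ a : Quiver.Total.{w, uI} I, a.left ≠ i)
    (hx : x ∈ kerSpace lam ν i V j (Delta i j)) {l : Fin n} {r : EdgesInto i}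
    (hj : j l = r.1.left) :
    shift lam ν l (Delta i j) (raise k r l x)
      ∈ kerSpace lam ν i V (Function.update j l i) (insert l (Delta i j)) := by
  rw [mem_kerSpace_iff] at hx ⊢
  have hl : l ∉ Delta i j := by
    rw [mem_Delta, hj]
    exact hi _
  have hy := raise_mem hx.1 hj i
  have hΔ : ∀ m ∈ insert l (Delta i j), Function.update j l i m = i := fun m hm => by
    rwa [← Delta_update_self, mem_Delta] at hm
  have hlΔ := Finset.mem_insert_self l (Delta i j)
  refine ⟨shift_mem hy hlΔ (Finset.subset_insert _ _) hΔ, ?_⟩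
  have hc := contract_mem hy (hΔ l hlΔ)
  rw [Finset.erase_insert hl] at hc
  have hcp : ∀ p ∈ Delta i j, contract lam ν p (raise k r l x) = 0 := fun p hp => by
    rw [contract_raise, hx.2 p hp, map_zero]
    rintro rfl
    exact hl hp
  intro p hp
  rw [shift_apply, map_add, map_add, map_neg, map_smul, map_smul, map_sum]
  rw [Finset.mem_insert] at hp
  rcases hp with rfl | hp
  -- At the new slot `-λ_i` cancels `π μ = λ_i`, and `π_p s_{mp} = s_{mp} π_m` gives zero because
  -- the contraction at the old slot `m` kills the raised family.
  · rw [contract_expand_self hi hc (hΔ p hlΔ)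
      (by rw [Delta_update_self, Finset.erase_insert hl]), neg_add_cancel, zero_add,
      Finset.sum_eq_zero, smul_zero]
    intro m hm
    have := permAct_contract (lam := lam) (ν := ν) (raise k r p x) (Equiv.swap m p) m
    rw [Equiv.swap_apply_left] at this
    rw [← this, hcp m hm, map_zero]
  -- At an old slot, `π_p μ_l π_l` leaves only `-ν s_{pl} π_l`, and the summand `m = p` gives `ν π_p
  -- s_{pl} = ν s_{pl} π_l`. The other summands commute with `π_p` and vanish.
  · have hpl : p ≠ l := by rintro rfl; exact hl hp
    rw [hcp p hp, contract_expand hc hp hl (hΔ l hlΔ), contract_contract _ hpl, hcp p hp, map_zero,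
      map_zero, Finset.sum_eq_single p]
    · have := permAct_contract (lam := lam) (ν := ν) (raise k r l x) (Equiv.swap p l) l
      rw [Equiv.swap_apply_right] at this
      rw [this]
      simp
    · intro m hm hmp
      have := permAct_contract (lam := lam) (ν := ν) (raise k r l x) (Equiv.swap m l) p
      rw [Equiv.swap_apply_of_ne_of_ne hmp.symm hpl] at this
      rw [← this, hcp p hp, map_zero]
    · exact fun h => absurd hp h

end Shift

/-! ### The new edge actions and the defining relations for the parameter `r_i λ`. -/

section Relations

variable {k : Type uk} [CommRing k] {I : Type uI} [Fintype I] [DecidableEq I]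
  [Quiver.{w} I] [Fintype (Quiver.Total.{w, uI} I)]
  [DecidableEq (Quiver.Total.{w, uI} I)] {n : ℕ} {lam : I → k} {ν : k} {i : I}
  {V : Type v} [AddCommGroup V] [Module (WreathAlg n lam ν) V] [Module k V]
  [IsScalarTower k (WreathAlg n lam ν) V]

variable (lam ν) in
/-- The operator `a'_ℓ|_j` in terms of operators on the whole ambient group. -/
def primeAct : DoubleEdge I → Fin n → (Fin n → I) → (Amb (n := n) i V →ₗ[k] Amb (n := n) i V)
  | Sum.inl a, l, j =>
      if h : a.right = i then shift lam ν l (Delta i j) ∘ₗ raise k ⟨a, h⟩ l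
      else Algebra.lsmul k k _ (arrow lam ν (Sum.inl a) l)
  | Sum.inr a, l, _ =>
      if h : a.right = i then lower k ⟨a, h⟩ l
      else Algebra.lsmul k k _ (arrow lam ν (Sum.inr a) l)

section

variable (x : Amb (n := n) i V) (l : Fin n) (j : Fin n → I)

theorem primeAct_raise (r : EdgesInto i) :
    primeAct lam ν (Sum.inl r.1) l j x = shift lam ν l (Delta i j) (raise k r l x) := by
  rw [primeAct, dif_pos r.2]
  rfl

theorem primeAct_lower (r : EdgesInto i) :
    primeAct lam ν (Sum.inr r.1) l j x = lower k r l x := by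
  rw [primeAct, dif_pos r.2]

theorem primeAct_inl {a : Quiver.Total.{w, uI} I} (h : a.right ≠ i) :
    primeAct lam ν (Sum.inl a) l j x = arrow lam ν (Sum.inl a) l • x := by
  rw [primeAct, dif_neg h]
  rfl

theorem primeAct_inr {a : Quiver.Total.{w, uI} I} (h : a.right ≠ i) :
    primeAct lam ν (Sum.inr a) l j x = arrow lam ν (Sum.inr a) l • x := by
  rw [primeAct, dif_neg h]
  rfl

theorem permAct_primeAct (σ : Equiv.Perm (Fin n)) (a : DoubleEdge I) :
    permAct lam ν σ (primeAct lam ν a l j x)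
      = primeAct lam ν a (σ l) (permTuple σ j) (permAct lam ν σ x) := by
  have hD : ∀ m, σ m ∈ Delta i (permTuple σ j) ↔ m ∈ Delta i j := fun m => by
    simp [mem_Delta, permTuple]
  rcases a with a | a
  · by_cases h : a.right = i
    · rw [primeAct_raise _ _ _ ⟨a, h⟩, primeAct_raise _ _ _ ⟨a, h⟩, permAct_shift _ _ _ hD,
        permAct_raise]
    · rw [primeAct_inl _ _ _ h, primeAct_inl _ _ _ h, permAct_arrow_smul]
  · by_cases h : a.right = i
    · rw [primeAct_lower _ _ _ ⟨a, h⟩, primeAct_lower _ _ _ ⟨a, h⟩, permAct_lower]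
    · rw [primeAct_inr _ _ _ h, primeAct_inr _ _ _ h, permAct_arrow_smul]

/-- `a` is an edge of the double with neither end at `i`, when `i` is a sink. -/
def Avoids (i : I) : DoubleEdge I → Prop
  | Sum.inl a => a.right ≠ i
  | Sum.inr a => a.right ≠ i

theorem Avoids.ne_inl {a : DoubleEdge I} (h : Avoids i a) (r : EdgesInto i) : a ≠ Sum.inl r.1 := by
  rintro rfl
  exact h r.2

theorem Avoids.ne_inr {a : DoubleEdge I} (h : Avoids i a) (r : EdgesInto i) : a ≠ Sum.inr r.1 := by
  rintro rfl
  exact h r.2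

theorem Avoids.head_ne (hi : ∀ a : Quiver.Total.{w, uI} I, a.left ≠ i) {a : DoubleEdge I}
    (h : Avoids i a) : head a ≠ i := by
  rcases a with a | a
  · exact h
  · exact hi a

theorem Avoids.tail_ne (hi : ∀ a : Quiver.Total.{w, uI} I, a.left ≠ i) {a : DoubleEdge I}
    (h : Avoids i a) : tail a ≠ i := by
  rcases a with a | a
  · exact hi a
  · exact h

theorem primeAct_avoids {a : DoubleEdge I} (h : Avoids i a) :
    primeAct lam ν a l j x = arrow lam ν a l • x := by
  rcases a with a | a
  · exact primeAct_inl _ _ _ h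
  · exact primeAct_inr _ _ _ h

theorem doubleEdge_cases (i : I) (a : DoubleEdge I) :
    Avoids i a ∨ (∃ r : EdgesInto i, a = Sum.inl r.1) ∨ ∃ r : EdgesInto i, a = Sum.inr r.1 := by
  rcases a with a | a
  · by_cases h : a.right = i
    · exact Or.inr (Or.inl ⟨⟨a, h⟩, rfl⟩)
    · exact Or.inl h
  · by_cases h : a.right = i
    · exact Or.inr (Or.inr ⟨⟨a, h⟩, rfl⟩)
    · exact Or.inl h

end

variable {x : Amb (n := n) i V} {j : Fin n → I} (hi : ∀ a : Quiver.Total.{w, uI} I, a.left ≠ i)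

include hi

theorem Delta_moveTuple_of_avoids {a : DoubleEdge I} (h : Avoids i a) {l : Fin n}
    (hj : j l = tail a) : Delta i (moveTuple a l j) = Delta i j := by
  rw [moveTuple, Delta_update_of_ne _ _ (h.head_ne hi), Finset.erase_eq_of_notMem]
  rw [mem_Delta, hj]
  exact h.tail_ne hi

omit hi in
theorem Delta_moveTuple_inl (r : EdgesInto i) (l : Fin n) :
    Delta i (moveTuple (Sum.inl r.1) l j) = insert l (Delta i j) := by
  rw [moveTuple, ← Delta_update_self]
  congr
  exact r.2

theorem Delta_moveTuple_inr (a : Quiver.Total.{w, uI} I) (l : Fin n) :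
    Delta i (moveTuple (Sum.inr a) l j) = (Delta i j).erase l :=
  Delta_update_of_ne _ _ (hi a)

theorem theta_eq {D : Finset (Fin n)} (hx : x ∈ sumSpace lam ν i V j D) (r : EdgesInto i)
    {l : Fin n} (hl : l ∉ D) (hj : j l = r.1.left) :
    theta lam ν V r l j D x = shift lam ν l D (raise k r l x) := by
  have hy := raise_mem hx hj (head (Sum.inl r.1))
  have hc := contract_mem hy (l := l) (by simpa [head] using r.2)
  rw [Finset.erase_insert hl] at hc
  rw [shift_apply, theta, AddMonoidHom.comp_apply, tauLower_eq hx r hl]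
  simp only [AddMonoidHom.add_apply, AddMonoidHom.neg_apply, AddMonoidHom.comp_apply,
    AddMonoidHom.finsetSum_apply]
  rw [moveTuple, piOp_eq hy, muOp_eq hc, Finset.sum_congr rfl fun m _ => permOp_eq hy _]
  congr 2
  · congr 1
    exact algebraMap_smul (WreathAlg n lam ν) (lam i) (raise k r l x)
  · exact algebraMap_smul (WreathAlg n lam ν) ν _

theorem primeOp_eq (hx : x ∈ sumSpace lam ν i V j (Delta i j)) (a : DoubleEdge I) {l : Fin n}
    (hj : j l = tail a) : primeOp lam ν i V a l j x = primeAct lam ν a l j x := by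
  rcases a with a | a
  · by_cases h : a.right = i
    · rw [primeOp, dif_pos h, primeAct_raise _ _ _ ⟨a, h⟩, theta_eq hi hx _ _ hj]
      rw [mem_Delta, hj]
      exact hi a
    · rw [primeOp, dif_neg h, primeAct_inl _ _ _ h, edgeOp_eq hx]
  · by_cases h : a.right = i
    · rw [primeOp, dif_pos h, primeAct_lower _ _ _ ⟨a, h⟩, tauUpper_eq hx]
    · rw [primeOp, dif_neg h, primeAct_inr _ _ _ h, edgeOp_eq hx]

theorem primeAct_mem (hx : x ∈ kerSpace lam ν i V j (Delta i j)) (a : DoubleEdge I) {l : Fin n}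
    (hj : j l = tail a) :
    primeAct lam ν a l j x ∈ kerSpace lam ν i V (moveTuple a l j) (Delta i (moveTuple a l j)) := by
  rcases doubleEdge_cases i a with h | ⟨r, rfl⟩ | ⟨r, rfl⟩
  · rw [primeAct_avoids _ _ _ h, Delta_moveTuple_of_avoids hi h hj]
    refine arrow_smul_mem_kerSpace hx ?_ h.ne_inr
    rw [mem_Delta, hj]
    exact h.tail_ne hi
  · rw [primeAct_raise, Delta_moveTuple_inl]
    have := shift_raise_mem_kerSpace hi hx (r := r) hj
    rwa [moveTuple, show head (Sum.inl r.1) = i from r.2]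
  · rw [primeAct_lower, Delta_moveTuple_inr hi]
    exact lower_mem_kerSpace hx r l

/-! ### The relation between two slots -/

omit hi in
-- Both slots are empty throughout the support, so exchanging them does not change the partial map.
theorem permAct_swap_of_notMem {D : Finset (Fin n)} (hx : x ∈ sumSpace lam ν i V j D) {l m : Fin n}
    (hl : l ∉ D) (hm : m ∉ D) :
    permAct lam ν (Equiv.swap l m) x = toAlg lam ν (.perm (Equiv.swap l m)) • x := by
  have key : ∀ ξ : PartialMap n i, ∀ p ∉ D, ξ p ≠ none → x ξ = 0 := fun ξ p hp h => by
    by_contra h0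
    rw [← dom_of_ne_zero hx h0, mem_dom] at hp
    exact hp h
  funext ξ
  rw [permAct_apply, Pi.smul_apply]
  congr 1
  by_cases h : ξ l = none ∧ ξ m = none
  · congr 1
    funext p
    rcases eq_or_ne p l with rfl | h1
    · rw [Equiv.swap_apply_left, h.1, h.2]
    · rcases eq_or_ne p m with rfl | h2
      · rw [Equiv.swap_apply_right, h.1, h.2]
      · rw [Equiv.swap_apply_of_ne_of_ne h1 h2]
  · by_cases h1 : ξ l = none
    · have h2 : ξ m ≠ none := fun h2 => h ⟨h1, h2⟩
      rw [key _ l hl (by simpa using h2), key _ m hm h2]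
    · rw [key _ m hm (by simpa using h1), key _ l hl h1]

variable (ν) in
/-- The coefficient of `s_{ℓ m}` in the commutator of `a_ℓ` and `b_m`. -/
def twoSlotCoeff (a b : DoubleEdge I) : k :=
  if b.isLeft ∧ a = star b then ν else if a.isLeft ∧ b = star a then -ν else 0

omit hi in
theorem twoSlotCoeff_swap (a b : DoubleEdge I) : twoSlotCoeff ν a b = -twoSlotCoeff ν b a := by
  rcases a with a | a <;> rcases b with b | b <;> simp [twoSlotCoeff, star] <;>
    split_ifs <;> simp

omit hi in
theorem twoSlotCoeff_eq_zero {a b : DoubleEdge I} (h : a ≠ star b) : twoSlotCoeff ν a b = 0 := by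
  rw [twoSlotCoeff, if_neg (fun t => h t.2), if_neg]
  rintro ⟨-, rfl⟩
  exact h (by simp [star])

omit hi in
theorem arrow_commutator {D : Finset (Fin n)} (hx : x ∈ sumSpace lam ν i V j D) {l m : Fin n}
    (hlm : l ≠ m) (hl : l ∉ D) (hm : m ∉ D) (a : Quiver.Total.{w, uI} I) (hjl : j l = a.left)
    (hjm : j m = a.right) :
    arrow lam ν (Sum.inl a) l • arrow lam ν (Sum.inr a) m • x
      - arrow lam ν (Sum.inr a) m • arrow lam ν (Sum.inl a) l • x
      = -ν • permAct lam ν (Equiv.swap l m) x := by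
  rw [permAct_swap_of_notMem hx hl hm]
  funext ξ
  by_cases h0 : x ξ = 0
  · simp [h0]
  · rw [← dom_of_ne_zero hx h0, mem_dom, not_not] at hl hm
    have := arrow_smul_reverse (apply_mem hx ξ) hlm a (by rw [tailTuple_of_none hl, hjl])
      (by rw [tailTuple_of_none hm, hjm])
    simp only [Pi.sub_apply, Pi.smul_apply]
    rw [this, neg_smul]
    abel

omit hi in
-- The slot maps in `l` pass through the shift over `D \ {l}`, so only the extra summand `ν s_{lm}`
-- of the shift over `D` survives. It brings `raise` into slot `l`, where `lower` detects whether
-- the two edges agree.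
theorem lower_shift_raise {D : Finset (Fin n)} (hx : x ∈ sumSpace lam ν i V j D) {l m : Fin n}
    (hlm : l ≠ m) (hl : l ∈ D) (hm : m ∉ D) (r r' : EdgesInto i) :
    lower k r l (shift lam ν m D (raise k r' m x))
      - shift lam ν m (D.erase l) (raise k r' m (lower k r l x))
    = (if r = r' then ν else 0) • permAct lam ν (Equiv.swap l m) x := by
  rw [← lower_raise x r r' hlm, shift_lower _ hlm (Finset.notMem_erase _ _)]
  conv_lhs => rw [← Finset.insert_erase hl, shift_insert _ (Finset.notMem_erase _ _)]
  rw [Finset.erase_insert (Finset.notMem_erase _ _), map_add, map_smul, add_sub_cancel_left,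
    permAct_raise, Equiv.swap_apply_right, lower_raise_self]
  · split_ifs <;> simp
  · intro ξ h
    have h' : x (fun p => ξ (Equiv.swap l m p)) ≠ 0 := fun h0 => h (by
      rw [permAct_apply, h0, smul_zero])
    rw [← dom_of_ne_zero hx h', mem_dom, not_not] at hm
    simpa using hm

/-- Each edge either avoids `i`, enters `i`, or leaves `i`, giving nine cases. Two edges avoiding
`i` reduce to the old relation; two entering edges need `shift_shift`; an entering and a leaving
edge need `lower_shift_raise`; the others are plain commutation. -/
theorem primeAct_commutator (hx : x ∈ kerSpace lam ν i V j (Delta i j)) {l m : Fin n}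
    (hlm : l ≠ m) (a b : DoubleEdge I) (ha : j l = tail a) (hb : j m = tail b) :
    primeAct lam ν a l (moveTuple b m j) (primeAct lam ν b m j x)
      - primeAct lam ν b m (moveTuple a l j) (primeAct lam ν a l j x)
      = twoSlotCoeff ν a b • permAct lam ν (Equiv.swap l m) x := by
  have hxs := (mem_kerSpace_iff.1 hx).1
  have hl : Avoids i a ∨ (∃ r : EdgesInto i, a = Sum.inl r.1) → l ∉ Delta i j := by
    rw [mem_Delta, ha]
    rintro (h | ⟨r, rfl⟩)
    · exact h.tail_ne hi
    · exact hi _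
  have hm : Avoids i b ∨ (∃ r : EdgesInto i, b = Sum.inl r.1) → m ∉ Delta i j := by
    rw [mem_Delta, hb]
    rintro (h | ⟨r, rfl⟩)
    · exact h.tail_ne hi
    · exact hi _
  have hne : ∀ {c : DoubleEdge I}, Avoids i c → ∀ r : EdgesInto i, c ≠ star (Sum.inl r.1) ∧
      c ≠ star (Sum.inr r.1) := fun h r => ⟨h.ne_inr r, h.ne_inl r⟩
  have hne' : ∀ {c : DoubleEdge I}, Avoids i c → ∀ r : EdgesInto i, Sum.inl r.1 ≠ star c ∧
      Sum.inr r.1 ≠ star c := fun {c} h r => by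
    rcases c with c | c <;> simp only [star, Sum.swap_inl, Sum.swap_inr] <;>
      refine ⟨?_, ?_⟩ <;> intro h' <;> cases h' <;> exact h r.2
  rcases doubleEdge_cases i a with hA | ⟨r, rfl⟩ | ⟨r, rfl⟩ <;>
    rcases doubleEdge_cases i b with hB | ⟨r', rfl⟩ | ⟨r', rfl⟩
  · simp only [primeAct_avoids _ _ _ hA, primeAct_avoids _ _ _ hB]
    by_cases h : a = star b
    · rcases b with b | b
      · subst h
        have := arrow_commutator hxs hlm.symm (hm (Or.inl hB)) (hl (Or.inl hA)) b hb ha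
        rw [← neg_sub, star, Sum.swap_inl, this, Equiv.swap_comm m l]
        simp [twoSlotCoeff, star]
      · subst h
        have := arrow_commutator hxs hlm (hl (Or.inl hA)) (hm (Or.inl hB)) b ha hb
        rw [star, Sum.swap_inr, this]
        simp [twoSlotCoeff, star]
    · rw [twoSlotCoeff_eq_zero h, zero_smul, arrow_smul_comm_amb x hlm h, sub_self]
  · rw [twoSlotCoeff_eq_zero (hne hA r').1, zero_smul, primeAct_avoids _ _ _ hA,
      primeAct_avoids _ _ _ hA, primeAct_raise, primeAct_raise, Delta_moveTuple_of_avoids hi hA ha,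
      raise_smul, shift_arrow_smul _ hlm (hl (Or.inl hA)) hA.ne_inl hA.ne_inr, sub_self]
  · rw [twoSlotCoeff_eq_zero (hne hA r').2, zero_smul, primeAct_avoids _ _ _ hA,
      primeAct_avoids _ _ _ hA, primeAct_lower, primeAct_lower, lower_smul, sub_self]
  · rw [twoSlotCoeff_eq_zero (hne' hB r).1, zero_smul, primeAct_avoids _ _ _ hB,
      primeAct_avoids _ _ _ hB, primeAct_raise, primeAct_raise, Delta_moveTuple_of_avoids hi hB hb,
      raise_smul, shift_arrow_smul _ hlm.symm (hm (Or.inl hB)) hB.ne_inl hB.ne_inr, sub_self]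
  · have hl' := hl (Or.inr ⟨r, rfl⟩)
    have hm' := hm (Or.inr ⟨r', rfl⟩)
    rw [twoSlotCoeff_eq_zero (by simp [star]), zero_smul, sub_eq_zero]
    simp only [primeAct_raise, Delta_moveTuple_inl]
    -- Moving both `raise` operators innermost leaves two shifts applied to one doubly raised
    -- family.
    rw [← shift_raise _ hlm hl', ← shift_raise _ hlm.symm hm', raise_raise _ _ _ hlm.symm]
    have h1 := raise_mem (raise_mem hxs (r := r') hb i) (r := r) (l := l)
      (by rw [Function.update_of_ne hlm]; exact ha) i
    exact shift_shift h1 hlm hl' hm' (by simp) (by simp [hlm.symm])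
  · have := lower_shift_raise (lam := lam) (ν := ν) hxs hlm.symm
      (by rw [mem_Delta, hb]; exact r'.2) (hl (Or.inr ⟨r, rfl⟩)) r' r
    rw [primeAct_lower, primeAct_lower, primeAct_raise, primeAct_raise, Delta_moveTuple_inr hi,
      ← neg_sub, this, twoSlotCoeff_swap, neg_smul, Equiv.swap_comm m l]
    congr 2
    simp [twoSlotCoeff, star, Subtype.ext_iff]
  · rw [twoSlotCoeff_eq_zero (hne' hB r).2, zero_smul, primeAct_avoids _ _ _ hB,
      primeAct_avoids _ _ _ hB, primeAct_lower, primeAct_lower, lower_smul, sub_self]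
  · have := lower_shift_raise (lam := lam) (ν := ν) hxs hlm
      (by rw [mem_Delta, ha]; exact r.2) (hm (Or.inr ⟨r', rfl⟩)) r r'
    rw [primeAct_lower, primeAct_lower, primeAct_raise, primeAct_raise, Delta_moveTuple_inr hi,
      this]
    congr 2
    simp [star, Subtype.ext_iff]
  · rw [twoSlotCoeff_eq_zero (by simp [star]), zero_smul]
    simp only [primeAct_lower]
    rw [lower_lower _ _ _ hlm, sub_self]

/-! ### The relation at one slot -/

/-- There is no loop at a sink, so `(ε_i, ε_i) = 2`. -/
theorem dualReflection_self : dualReflection i lam i = -lam i := by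
  have h : ∀ a : Quiver.Total.{w, uI} I,
      (Pi.single i 1 : I → ℤ) a.left * (Pi.single i 1 : I → ℤ) a.right = 0 := fun a => by
    rw [Pi.single_eq_of_ne (hi a), zero_mul]
  simp only [dualReflection, symForm, ringelForm, h, Finset.sum_const_zero]
  simp [Pi.single_apply]
  ring

/-- Only one order of the Ringel form sees edges, since none leaves `i`; hence `(ε_i, ε_v)` is minus
the number of edges from `v` to `i`. -/
theorem dualReflection_of_ne {v : I} (hv : v ≠ i) :
    dualReflection i lam v = lam v +
      ((Finset.univ.filter fun r : EdgesInto i => r.1.left = v).card : k) * lam i := by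
  have h : ∀ a : Quiver.Total.{w, uI} I,
      (Pi.single i 1 : I → ℤ) a.left * (Pi.single v 1 : I → ℤ) a.right = 0 := fun a => by
    rw [Pi.single_eq_of_ne (hi a), zero_mul]
  have h2 : ∑ a : Quiver.Total.{w, uI} I,
      (Pi.single v 1 : I → ℤ) a.left * (Pi.single i 1 : I → ℤ) a.right
        = ((Finset.univ.filter fun r : EdgesInto i => r.1.left = v).card : ℤ) := by
    rw [← sum_edgesInto (i := i)]
    · simp only [Finset.card_filter, Nat.cast_sum]
      refine Finset.sum_congr rfl fun r _ => ?_
      rw [r.2]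
      simp [Pi.single_apply]
    · intro a ha
      rw [Pi.single_eq_of_ne ha, mul_zero]
  simp only [dualReflection, symForm, ringelForm, h, h2, Finset.sum_const_zero]
  simp [Pi.single_apply, hv, hv.symm]

omit hi in
theorem arrow_smul_eq_zero_amb {D : Finset (Fin n)} (hx : x ∈ sumSpace lam ν i V j D) {l : Fin n}
    (hl : l ∉ D) {a : DoubleEdge I} (h : j l ≠ tail a) : arrow lam ν a l • x = 0 := by
  funext ξ
  by_cases h0 : x ξ = 0
  · simp [h0]
  · rw [← dom_of_ne_zero hx h0, mem_dom, not_not] at hl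
    exact arrow_smul_eq_zero (apply_mem hx ξ) (by rwa [tailTuple_of_none hl])

omit hi in
-- `raise` and `lower` pick the diagonal entry at `r`: it is the identity for the scalar part, and
-- for `μ_l π_l` only the term `r* r` of the expansion-contraction remains.
theorem lower_shift_raise_self {D : Finset (Fin n)} (hx : x ∈ sumSpace lam ν i V j D) {l : Fin n}
    (hl : l ∉ D) (r : EdgesInto i) :
    lower k r l (shift lam ν l D (raise k r l x))
      = -(lam i • x) + arrow lam ν (Sum.inr r.1) l • arrow lam ν (Sum.inl r.1) l • x
        + ν • ∑ m ∈ D, lower k r l (raise k r m (permAct lam ν (Equiv.swap m l) x)) := by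
  have hxl : ∀ ξ, x ξ ≠ 0 → ξ l = none := fun ξ h => by
    rw [← dom_of_ne_zero hx h, mem_dom, not_not] at hl
    exact hl
  rw [shift_apply, map_add, map_add, map_neg, map_smul, map_smul, map_sum,
    lower_raise_self _ _ _ hxl, if_pos rfl]
  congr 2
  · funext ξ
    rw [lower_apply]
    by_cases h : ξ l = none
    · rw [if_pos h, expand_apply_of_some _ (extend_apply_self _ _ _), restr_extend_of_eq h,
        contract_apply_of_none _ h, Finset.sum_eq_single r]
      · rw [raise_apply, if_pos (extend_apply_self _ _ _), restr_extend_of_eq h]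
        rfl
      · intro r' _ hr
        rw [raise_apply, extend_apply_self, if_neg (by simpa using hr), smul_zero]
      · simp
    · have : x ξ = 0 := by
        by_contra h0
        exact h (hxl ξ h0)
      rw [if_neg h, Pi.smul_apply, Pi.smul_apply, this, smul_zero, smul_zero]
  · refine Finset.sum_congr rfl fun m _ => ?_
    rw [permAct_raise, Equiv.swap_apply_right]

omit hi in
-- The transposition carries the value of slot `m` away and `raise` puts `r` back, so the composite
-- tests whether `ξ m = r` and otherwise leaves the partial map unchanged.
theorem lower_raise_permAct_apply {D : Finset (Fin n)} (hx : x ∈ sumSpace lam ν i V j D)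
    {l m : Fin n} (hl : l ∉ D) (hlm : l ≠ m) (r : EdgesInto i) (ξ : PartialMap n i) :
    lower k r l (raise k r m (permAct lam ν (Equiv.swap m l) x)) ξ
      = if ξ m = some r then toAlg lam ν (.perm (Equiv.swap m l)) • x ξ else 0 := by
  rw [lower_apply]
  by_cases h : ξ l = none
  · rw [if_pos h, raise_apply, extend_apply_ne _ hlm.symm]
    refine ite_congr rfl (fun hm => ?_) fun _ => rfl
    rw [permAct_apply]
    congr 2
    funext p
    rcases eq_or_ne p m with rfl | h1
    · rw [Equiv.swap_apply_left, restr_apply_ne hlm, extend_apply_self, hm]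
    · rcases eq_or_ne p l with rfl | h2
      · rw [Equiv.swap_apply_right, restr_apply_self, h]
      · rw [Equiv.swap_apply_of_ne_of_ne h1 h2, restr_apply_ne h1, extend_apply_ne _ h2]
  · have : x ξ = 0 := by
      by_contra h0
      rw [← dom_of_ne_zero hx h0, mem_dom, not_not] at hl
      exact h hl
    rw [if_neg h, this, smul_zero, ite_self]

/-- Relation (i) is applied in the summand `V_{t(j,ξ)}`. The slots where `t(j, ξ)` agrees with `j l`
are of two kinds: empty ones with `j m = j l`, and slots of `Δ(j)` filled by an edge with tail `j
l`. The last sum collects the second kind. -/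
theorem sum_arrow_commutator (hx : x ∈ sumSpace lam ν i V j (Delta i j)) {l : Fin n}
    (hl : j l ≠ i) :
    ∑ a : Quiver.Total.{w, uI} I,
        (arrow lam ν (Sum.inl a) l • arrow lam ν (Sum.inr a) l • x
          - arrow lam ν (Sum.inr a) l • arrow lam ν (Sum.inl a) l • x)
      = lam (j l) • x
        + ν • ∑ m : Fin n with m ≠ l ∧ j m = j l, permAct lam ν (Equiv.swap l m) x
        + ν • ∑ r : EdgesInto i with r.1.left = j l, ∑ m ∈ Delta i j,
            lower k r l (raise k r m (permAct lam ν (Equiv.swap m l) x)) := by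
  have hlΔ : l ∉ Delta i j := by rwa [mem_Delta]
  have h1 : ∀ m ∈ Finset.univ.filter (fun m => m ≠ l ∧ j m = j l),
      permAct lam ν (Equiv.swap l m) x = toAlg lam ν (.perm (Equiv.swap l m)) • x := fun m hm => by
    refine permAct_swap_of_notMem hx hlΔ ?_
    rw [mem_Delta, (Finset.mem_filter.1 hm).2.2]
    exact hl
  rw [Finset.sum_congr rfl h1, Finset.sum_comm]
  funext ξ
  simp only [Finset.sum_apply, Pi.sub_apply, Pi.add_apply, Pi.smul_apply]
  have h2 : ∀ m ∈ Delta i j, ∑ r : EdgesInto i with r.1.left = j l,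
      lower k r l (raise k r m (permAct lam ν (Equiv.swap m l) x)) ξ
      = ∑ r : EdgesInto i with r.1.left = j l,
        if ξ m = some r then toAlg lam ν (.perm (Equiv.swap l m)) • x ξ else 0 := fun m hm =>
    Finset.sum_congr rfl fun r _ => by
      rw [lower_raise_permAct_apply hx hlΔ (by rintro rfl; exact hlΔ hm), Equiv.swap_comm m l]
  rw [Finset.sum_congr rfl h2]
  by_cases h0 : x ξ = 0
  · simp [h0]
  · have hdom := dom_of_ne_zero hx h0
    have hξl : ξ l = none := by
      rw [← hdom, mem_dom, not_not] at hlΔ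
      exact hlΔ
    rw [sum_commutator_smul (apply_mem hx ξ) l, tailTuple_of_none hξl, add_assoc, ← smul_add]
    congr 2
    simp only [Delta, Finset.sum_filter]
    rw [← Finset.sum_add_distrib]
    refine Finset.sum_congr rfl fun m _ => ?_
    -- Each slot feeds exactly one of the two sums: slots at `i` the second, all others the first.
    by_cases hm : j m = i
    · have hml : m ≠ l := by rintro rfl; exact hl hm
      have hmd : m ∈ dom ξ := by rwa [hdom, mem_Delta]
      obtain ⟨r, hr⟩ := Option.ne_none_iff_exists'.1 (mem_dom.1 hmd)
      rw [if_pos hm, tailTuple_of_some hr, if_neg (fun h : m ≠ l ∧ j m = j l => hl (h.2 ▸ hm)),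
        zero_add, Finset.sum_eq_single r]
      · simp [hr, hml]
      · intro r' _ hr'
        rw [hr, if_neg (fun h => hr' (Option.some.inj h).symm), ite_self]
      · simp
    · have hmd : ξ m = none := by
        by_contra h
        rw [← ne_eq, ← mem_dom, hdom, mem_Delta] at h
        exact hm h
      rw [if_neg hm, add_zero, tailTuple_of_none hmd]

/-- At `j l = i` the operators `raise_r lower_r` sum to the identity and the contraction vanishes,
so only the scalar and transpositions of the shift are left. Elsewhere the new commutator is the old
one plus a defect for each edge from `j l` to `i`; the scalar defects account for the reflection of
`λ` and the others cancel the last sum of `sum_arrow_commutator`. The `if`s encode the convention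
that edges with the wrong tail act by zero. -/
theorem primeAct_sum_commutator (hx : x ∈ kerSpace lam ν i V j (Delta i j)) (l : Fin n) :
    ∑ a : Quiver.Total.{w, uI} I,
        ((if j l = a.right then primeAct lam ν (Sum.inl a) l (moveTuple (Sum.inr a) l j)
            (primeAct lam ν (Sum.inr a) l j x) else 0)
          - (if j l = a.left then primeAct lam ν (Sum.inr a) l (moveTuple (Sum.inl a) l j)
            (primeAct lam ν (Sum.inl a) l j x) else 0))
      = dualReflection i lam (j l) • x
        + ν • ∑ m : Fin n with m ≠ l ∧ j m = j l, permAct lam ν (Equiv.swap l m) x := by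
  obtain ⟨hxs, hxc⟩ := mem_kerSpace_iff.1 hx
  by_cases hl : j l = i
  · have hlΔ : l ∈ Delta i j := mem_Delta.2 hl
    have h1 : ∀ r : EdgesInto i,
        ((if j l = r.1.right then primeAct lam ν (Sum.inl r.1) l (moveTuple (Sum.inr r.1) l j)
            (primeAct lam ν (Sum.inr r.1) l j x) else 0)
          - (if j l = r.1.left then primeAct lam ν (Sum.inr r.1) l (moveTuple (Sum.inl r.1) l j)
            (primeAct lam ν (Sum.inl r.1) l j x) else 0))
        = shift lam ν l ((Delta i j).erase l) (raise k r l (lower k r l x)) := fun r => by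
      rw [if_pos (by rw [hl, r.2]), if_neg (by rw [hl]; exact (hi _).symm), sub_zero,
        primeAct_raise, primeAct_lower, Delta_moveTuple_inr hi]
    rw [← sum_edgesInto (i := i), Finset.sum_congr rfl fun r _ => h1 r, ← map_sum,
      sum_raise_lower, shift_apply, hxc l hlΔ, map_zero, add_zero, hl, dualReflection_self hi,
      neg_smul]
    · congr 2
      refine Finset.sum_congr ?_ fun m _ => by rw [Equiv.swap_comm]
      ext m
      simp [mem_Delta]
    · intro ξ h
      rwa [← dom_of_ne_zero hxs h, mem_dom] at hlΔ
    · intro a ha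
      rw [if_neg (by rw [hl]; exact ha.symm), if_neg (by rw [hl]; exact (hi _).symm), sub_zero]
  · have hlΔ : l ∉ Delta i j := by rwa [mem_Delta]
    -- The amount by which replacing `r* r` with `lower_r shift raise_r` changes the commutator.
    let c : EdgesInto i → Amb (n := n) i V := fun r =>
      if r.1.left = j l then lam i • x - ν • ∑ m ∈ Delta i j,
          lower k r l (raise k r m (permAct lam ν (Equiv.swap m l) x)) else 0
    have key : ∀ a : Quiver.Total.{w, uI} I,
        ((if j l = a.right then primeAct lam ν (Sum.inl a) l (moveTuple (Sum.inr a) l j)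
            (primeAct lam ν (Sum.inr a) l j x) else 0)
          - (if j l = a.left then primeAct lam ν (Sum.inr a) l (moveTuple (Sum.inl a) l j)
            (primeAct lam ν (Sum.inl a) l j x) else 0))
        = (arrow lam ν (Sum.inl a) l • arrow lam ν (Sum.inr a) l • x
          - arrow lam ν (Sum.inr a) l • arrow lam ν (Sum.inl a) l • x)
          + if h : a.right = i then c ⟨a, h⟩ else 0 := by
      intro a
      by_cases h : a.right = i
      · rw [dif_pos h, if_neg (by rw [h]; exact hl),
          arrow_smul_eq_zero_amb hxs hlΔ (a := Sum.inr a) (by simpa [tail, h] using hl), smul_zero]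
        by_cases h' : j l = a.left
        · rw [if_pos h', primeAct_raise _ _ _ ⟨a, h⟩, primeAct_lower _ _ _ ⟨a, h⟩,
            lower_shift_raise_self hxs hlΔ]
          simp only [c, if_pos h'.symm]
          abel
        · rw [if_neg h', arrow_smul_eq_zero_amb hxs hlΔ (a := Sum.inl a) h']
          simp [c, Ne.symm h']
      · rw [dif_neg h, add_zero]
        simp only [primeAct_inl _ _ _ h, primeAct_inr _ _ _ h]
        congr 1
        · split_ifs with h'
          · rfl
          · rw [arrow_smul_eq_zero_amb hxs hlΔ (a := Sum.inr a) h', smul_zero]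
        · split_ifs with h'
          · rfl
          · rw [arrow_smul_eq_zero_amb hxs hlΔ (a := Sum.inl a) h', smul_zero]
    have hc : ∑ a : Quiver.Total.{w, uI} I, (if h : a.right = i then c ⟨a, h⟩ else 0)
        = ∑ r, c r := by
      rw [← sum_edgesInto (i := i) _ fun a ha => dif_neg ha]
      exact Finset.sum_congr rfl fun r _ => dif_pos r.2
    rw [Finset.sum_congr rfl fun a _ => key a, Finset.sum_add_distrib, hc,
      sum_arrow_commutator hi hxs hl, dualReflection_of_ne hi hl]
    simp only [c, ← Finset.sum_filter, Finset.sum_sub_distrib, ← Finset.smul_sum,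
      Finset.sum_const, add_smul, mul_smul, Nat.cast_smul_eq_nsmul]
    rw [smul_comm (lam i) (Finset.card _) x]
    abel

end Relations

/-! ### The generators acting on `F_i(V)`, and descent of the action to the algebra. -/

section Action

variable {k : Type uk} [CommRing k] {I : Type uI} [Fintype I] [DecidableEq I]
  [Quiver.{w} I] [Fintype (Quiver.Total.{w, uI} I)]
  [DecidableEq (Quiver.Total.{w, uI} I)] {n : ℕ} {lam : I → k} {ν : k} {i : I}
  {V : Type v} [AddCommGroup V] [Module (WreathAlg n lam ν) V] [Module k V]
  [IsScalarTower k (WreathAlg n lam ν) V]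

theorem smul_mem_kerSpace {x : Amb (n := n) i V} {j : Fin n → I} {D : Finset (Fin n)}
    (hx : x ∈ kerSpace lam ν i V j D) (c : k) : c • x ∈ kerSpace lam ν i V j D := by
  rw [mem_kerSpace_iff] at hx ⊢
  refine ⟨smul_mem_sumSpace hx.1 c, fun p hp => ?_⟩
  rw [map_smul, hx.2 p hp, smul_zero]

instance : SMul k (reflSpace n lam ν i V) where
  smul c x := ⟨c • x.1, (mem_reflSpace lam ν i _).2 fun j =>
    smul_mem_kerSpace ((mem_reflSpace lam ν i _).1 x.2 j) c⟩

instance : Module k (reflSpace n lam ν i V) :=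
  Function.Injective.module k (reflSpace n lam ν i V).subtype Subtype.val_injective fun _ _ => rfl

theorem coe_smul_reflSpace (c : k) (x : reflSpace n lam ν i V) : (c • x).1 = c • x.1 := rfl

variable (lam ν) in
/-- The operators on all families by which the generators are to act. -/
def genOp : Gen I n → ((Fin n → I) → Amb (n := n) i V) →ₗ[k] ((Fin n → I) → Amb (n := n) i V)
  | .idem j => LinearMap.single k _ j ∘ₗ LinearMap.proj j
  | .perm σ => LinearMap.pi fun j => permAct lam ν σ ∘ₗ LinearMap.proj (permTuple σ⁻¹ j)
  | .edge a l j =>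
      if j l = tail a then
        LinearMap.single k _ (moveTuple a l j) ∘ₗ primeAct lam ν a l j ∘ₗ LinearMap.proj j
      else 0

section

variable (x : (Fin n → I) → Amb (n := n) i V)

theorem genOp_idem (j : Fin n → I) : genOp lam ν (.idem j) x = Pi.single j (x j) := rfl

theorem genOp_perm (σ : Equiv.Perm (Fin n)) (j : Fin n → I) :
    genOp lam ν (.perm σ) x j = permAct lam ν σ (x (permTuple σ⁻¹ j)) := rfl

theorem genOp_edge {a : DoubleEdge I} {l : Fin n} {j : Fin n → I} (h : j l = tail a) :
    genOp lam ν (.edge a l j) x = Pi.single (moveTuple a l j) (primeAct lam ν a l j (x j)) := by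
  rw [genOp, if_pos h]
  rfl

theorem genOp_edge_of_ne {a : DoubleEdge I} {l : Fin n} {j : Fin n → I} (h : j l ≠ tail a) :
    genOp lam ν (.edge a l j) x = 0 := by
  rw [genOp, if_neg h]
  rfl

theorem permTuple_inv_permTuple (σ : Equiv.Perm (Fin n)) (j : Fin n → I) :
    permTuple σ⁻¹ (permTuple σ j) = j := by
  funext m
  simp [permTuple]

theorem permTuple_permTuple_inv (σ : Equiv.Perm (Fin n)) (j : Fin n → I) :
    permTuple σ (permTuple σ⁻¹ j) = j := by
  funext m
  simp [permTuple]

theorem genOp_perm_single (σ : Equiv.Perm (Fin n)) (j : Fin n → I) (y : Amb (n := n) i V) :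
    genOp lam ν (.perm σ) (Pi.single j y) = Pi.single (permTuple σ j) (permAct lam ν σ y) := by
  funext j'
  rw [genOp_perm]
  by_cases h : j' = permTuple σ j
  · subst h
    rw [permTuple_inv_permTuple, Pi.single_eq_same, Pi.single_eq_same]
  · rw [Pi.single_eq_of_ne h, Pi.single_eq_of_ne, map_zero]
    rintro rfl
    exact h (permTuple_permTuple_inv σ j').symm

theorem permTuple_moveTuple (σ : Equiv.Perm (Fin n)) (a : DoubleEdge I) (l : Fin n)
    (j : Fin n → I) : moveTuple a (σ l) (permTuple σ j) = permTuple σ (moveTuple a l j) := by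
  funext m
  obtain ⟨m, rfl⟩ := σ.surjective m
  by_cases h : m = l <;> simp [moveTuple, permTuple, h]

theorem permTuple_swap (l m : Fin n) {j : Fin n → I} (h : j m = j l) :
    permTuple (Equiv.swap l m) j = j := by
  funext p
  simp only [permTuple, Equiv.swap_inv]
  rcases eq_or_ne p l with rfl | h1
  · rw [Equiv.swap_apply_left, h]
  · rcases eq_or_ne p m with rfl | h2
    · rw [Equiv.swap_apply_right, h]
    · rw [Equiv.swap_apply_of_ne_of_ne h1 h2]

theorem moveTuple_comm {l m : Fin n} (hlm : l ≠ m) (a b : DoubleEdge I) (j : Fin n → I) :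
    moveTuple a l (moveTuple b m j) = moveTuple b m (moveTuple a l j) :=
  Function.update_comm hlm.symm _ _ _

/-- Moving along an edge and its reverse in two slots exchanges the two vertices, so both sides of
relation (ii) lie in the same summand. -/
theorem moveTuple_star {l m : Fin n} (hlm : l ≠ m) {a : DoubleEdge I} {j : Fin n → I}
    (hl : j l = tail a) (hm : j m = head a) :
    moveTuple a l (moveTuple (star a) m j) = permTuple (Equiv.swap l m) j := by
  have hs : head (star a) = tail a := by rcases a with a | a <;> rfl
  funext p
  simp only [permTuple, Equiv.swap_inv]
  rcases eq_or_ne p l with rfl | h1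
  · simp [moveTuple, hm]
  · rcases eq_or_ne p m with rfl | h2
    · simp [moveTuple, hl, hlm.symm, hs]
    · rw [Equiv.swap_apply_of_ne_of_ne h1 h2]
      simp [moveTuple, h1, h2]

end

variable (hi : ∀ a : Quiver.Total.{w, uI} I, a.left ≠ i)

include hi in
theorem genOp_mem {x : (Fin n → I) → Amb (n := n) i V} (hx : x ∈ reflSpace n lam ν i V)
    (g : Gen I n) : genOp lam ν g x ∈ reflSpace n lam ν i V := by
  rw [mem_reflSpace] at hx ⊢
  have hs : ∀ {j : Fin n → I} {y : Amb (n := n) i V}, y ∈ kerSpace lam ν i V j (Delta i j) →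
      ∀ j' : Fin n → I, (Pi.single j y : (Fin n → I) → Amb (n := n) i V) j'
        ∈ kerSpace lam ν i V j' (Delta i j') := by
    intro j y hy j'
    by_cases h : j' = j
    · subst h
      rwa [Pi.single_eq_same]
    · rw [Pi.single_eq_of_ne h]
      exact zero_mem _
  rcases g with j | ⟨a, l, j⟩ | σ
  · rw [genOp_idem]
    exact hs (hx j)
  · by_cases h : j l = tail a
    · rw [genOp_edge _ h]
      exact hs (primeAct_mem hi (hx j) a h)
    · rw [genOp_edge_of_ne _ h]
      exact fun _ => zero_mem _
  · intro j
    rw [genOp_perm]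
    have := permAct_mem_kerSpace (hx (permTuple σ⁻¹ j)) σ (D' := Delta i j) fun m => by
      simp [mem_Delta, permTuple]
    rwa [permTuple_permTuple_inv] at this

/-- The action of a generator on `F_i(V)`. -/
def genAct (g : Gen I n) : Module.End k (reflSpace n lam ν i V) where
  toFun x := ⟨genOp lam ν g x.1, genOp_mem hi x.2 g⟩
  map_add' x y := Subtype.ext (map_add (genOp lam ν g) x.1 y.1)
  map_smul' c x := Subtype.ext (map_smul (genOp lam ν g) c x.1)

theorem coe_genAct (g : Gen I n) (x : reflSpace n lam ν i V) :
    (genAct hi g x).1 = genOp lam ν g x.1 := rfl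

variable (V) (lam) (ν) in
/-- The action of the free algebra on `F_i(V)`. -/
def freeAction : FreeAlgebra k (Gen I n) →ₐ[k] Module.End k (reflSpace n lam ν i V) :=
  FreeAlgebra.lift k (genAct hi)

theorem freeAction_gen (g : Gen I n) : freeAction lam ν V hi (gen k g) = genAct hi g :=
  FreeAlgebra.lift_ι_apply _ _

theorem freeAction_rel {a b : FreeAlgebra k (Gen I n)} (h : SmashRel k a b) :
    freeAction lam ν V hi a = freeAction lam ν V hi b := by
  refine LinearMap.ext fun x => Subtype.ext ?_
  rcases h with j | ⟨j, j', h⟩ | _ | ⟨a, l, j, h⟩ | ⟨a, l, j⟩ | ⟨a, l, j⟩ | _ | ⟨σ, σ'⟩ | ⟨σ, j⟩ |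
    ⟨σ, a, l, j⟩ <;>
  simp only [map_mul, map_zero, map_one, map_sum, freeAction_gen, Module.End.mul_apply, coe_genAct,
    LinearMap.zero_apply, Module.End.one_apply, LinearMap.sum_apply, AddSubgroup.val_finsetSum,
    ZeroMemClass.coe_zero]
  · simp [genOp_idem]
  · simp [genOp_idem, h]
  · simp only [genOp_idem]
    exact Finset.univ_sum_single x.1
  · rw [genOp_edge_of_ne _ h]
  · by_cases h : j l = tail a
    · simp [genOp_idem, genOp_edge _ h]
    · simp [genOp_edge_of_ne _ h]
  · by_cases h : j l = tail a
    · simp [genOp_idem, genOp_edge _ h]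
    · simp [genOp_edge_of_ne _ h]
  · funext j
    rw [genOp_perm, permAct_one]
    rfl
  · funext j
    simp only [genOp_perm, permAct_mul]
    congr 4
  · simp only [genOp_idem, genOp_perm_single]
    rw [genOp_perm, permTuple_inv_permTuple]
  · have hσ : permTuple σ j (σ l) = j l := by simp [permTuple]
    by_cases h : j l = tail a
    · rw [genOp_edge _ h, genOp_edge _ (hσ.trans h), genOp_perm_single, genOp_perm,
        permTuple_inv_permTuple, permAct_primeAct, permTuple_moveTuple]
    · rw [genOp_edge_of_ne _ h, genOp_edge_of_ne _ (fun h' => h (hσ ▸ h')), map_zero]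

variable (V) (lam) (ν) in
/-- The action of `T_𝓑 𝓔 ⋊ k[S_n]` on `F_i(V)`. -/
def smashAction : SmashAlg k I n →ₐ[k] Module.End k (reflSpace n lam ν i V) :=
  RingQuot.liftAlgHom k ⟨freeAction lam ν V hi, fun _ _ h => freeAction_rel hi h⟩

theorem smashAction_mk (a : FreeAlgebra k (Gen I n)) :
    smashAction lam ν V hi (RingQuot.mkAlgHom k (SmashRel k) a) = freeAction lam ν V hi a :=
  RingQuot.liftAlgHom_mkAlgHom_apply ..

theorem smashAction_gen (g : Gen I n) :
    smashAction lam ν V hi (smashGen k g) = genAct hi g := by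
  rw [smashGen, smashAction_mk, freeAction_gen]

theorem smashAction_rel {a b : SmashAlg k I n} (h : WreathRel (dualReflection i lam) ν a b) :
    smashAction lam ν V hi a = smashAction lam ν V hi b := by
  refine LinearMap.ext fun x => Subtype.ext ?_
  have hker := fun j => (mem_reflSpace lam ν i x.1).1 x.2 j
  rcases h with ⟨l, j⟩ | ⟨l, m, hlm, a, b, j, ha, hb⟩
  -- A path along an edge and back returns to `j`, so the whole relation lives in the summand of
  -- `j`.
  · have hterm : ∀ a : Quiver.Total.{w, uI} I,
        genOp lam ν (.edge (Sum.inl a) l (moveTuple (Sum.inr a) l j))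
            (genOp lam ν (.edge (Sum.inr a) l j) x.1)
          - genOp lam ν (.edge (Sum.inr a) l (moveTuple (Sum.inl a) l j))
            (genOp lam ν (.edge (Sum.inl a) l j) x.1)
        = LinearMap.single k _ j
          ((if j l = a.right then primeAct lam ν (Sum.inl a) l (moveTuple (Sum.inr a) l j)
            (primeAct lam ν (Sum.inr a) l j (x.1 j)) else 0)
          - (if j l = a.left then primeAct lam ν (Sum.inr a) l (moveTuple (Sum.inl a) l j)
            (primeAct lam ν (Sum.inl a) l j (x.1 j)) else 0)) := by
      intro a
      rw [map_sub]
      congr 1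
      · split_ifs with h
        · rw [genOp_edge (a := Sum.inr a) _ h, genOp_edge _ (by simp [moveTuple, head, tail]),
            Pi.single_eq_same]
          have : moveTuple (Sum.inl a) l (moveTuple (Sum.inr a) l j) = j := by
            simp [moveTuple, head, ← h]
          rw [this]
          rfl
        · rw [genOp_edge_of_ne (a := Sum.inr a) _ h, map_zero, map_zero]
      · split_ifs with h
        · rw [genOp_edge (a := Sum.inl a) _ h, genOp_edge _ (by simp [moveTuple, head, tail]),
            Pi.single_eq_same]
          have : moveTuple (Sum.inr a) l (moveTuple (Sum.inl a) l j) = j := by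
            simp [moveTuple, head, ← h]
          rw [this]
          rfl
        · rw [genOp_edge_of_ne (a := Sum.inl a) _ h, map_zero, map_zero]
    have hperm : ∀ m ∈ Finset.univ.filter (fun m => m ≠ l ∧ j m = j l),
        genOp lam ν (.perm (Equiv.swap l m)) (genOp lam ν (.idem j) x.1)
          = LinearMap.single k _ j (permAct lam ν (Equiv.swap l m) (x.1 j)) := fun m hm => by
      rw [genOp_idem, genOp_perm_single, permTuple_swap l m (Finset.mem_filter.1 hm).2.2]
      rfl
    simp only [map_sub, map_sum, map_mul, map_smul, smashAction_gen, LinearMap.sub_apply,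
      LinearMap.sum_apply, LinearMap.smul_apply, Module.End.mul_apply, AddSubgroup.coe_sub,
      AddSubgroup.val_finsetSum, coe_smul_reflSpace, coe_genAct]
    rw [Finset.sum_congr rfl fun a _ => hterm a, ← map_sum, Finset.sum_congr rfl hperm, ← map_sum,
      primeAct_sum_commutator hi (hker j) l, map_add, map_smul, map_smul]
    exact add_sub_cancel_left _ _
  · have hrhs : smashAction lam ν V hi (if b.isLeft ∧ a = star b then
            ν • (smashGen k (.perm (Equiv.swap l m)) * smashGen k (.idem j))
          else if a.isLeft ∧ b = star a then
            -(ν • (smashGen k (.perm (Equiv.swap l m)) * smashGen k (.idem j)))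
          else 0)
        = twoSlotCoeff ν a b • (genAct hi (.perm (Equiv.swap l m)) * genAct hi (.idem j)) := by
      rw [twoSlotCoeff]
      split_ifs <;> simp [smashAction_gen]
    have hb' : moveTuple a l j m = tail b := by
      rw [moveTuple, Function.update_of_ne hlm.symm, hb]
    have ha' : moveTuple b m j l = tail a := by
      rw [moveTuple, Function.update_of_ne hlm, ha]
    rw [hrhs]
    simp only [map_sub, map_mul, smashAction_gen, LinearMap.sub_apply, LinearMap.smul_apply,
      Module.End.mul_apply, AddSubgroup.coe_sub, coe_smul_reflSpace, coe_genAct]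
    rw [genOp_edge _ hb, genOp_edge _ ha', genOp_edge _ ha, genOp_edge _ hb', Pi.single_eq_same,
      Pi.single_eq_same, moveTuple_comm hlm.symm b a, ← Pi.single_sub,
      primeAct_commutator hi (hker j) hlm a b ha hb, genOp_idem, genOp_perm_single,
      ← Pi.single_smul]
    -- The target tuples of the two sides must agree only when the coefficient can be nonzero.
    by_cases hab : a = star b
    · have hba : b = star a := by rw [hab]; simp [star]
      have hh : j m = head a := by
        rw [hb, hab]
        rcases b with b | b <;> rfl
      rw [hba, moveTuple_star hlm ha hh]
    · rw [twoSlotCoeff_eq_zero hab, zero_smul, Pi.single_zero, Pi.single_zero]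

variable (V) (lam) (ν) in
/-- The action of `𝓐_{n, r_i λ, ν}` on `F_i(V)`. -/
def reflAction :
    WreathAlg n (dualReflection i lam) ν →ₐ[k] Module.End k (reflSpace n lam ν i V) :=
  RingQuot.liftAlgHom k ⟨smashAction lam ν V hi, fun _ _ h => smashAction_rel hi h⟩

theorem reflAction_mk (a : FreeAlgebra k (Gen I n)) :
    reflAction lam ν V hi (RingQuot.mkAlgHom k (WreathRel (dualReflection i lam) ν)
      (RingQuot.mkAlgHom k (SmashRel k) a)) = freeAction lam ν V hi a := by
  rw [reflAction, RingQuot.liftAlgHom_mkAlgHom_apply, smashAction_mk]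

theorem reflAction_toAlg (g : Gen I n) (x : reflSpace n lam ν i V) :
    (reflAction lam ν V hi (toAlg (dualReflection i lam) ν g) x).1 = genOp lam ν g x.1 := by
  rw [toAlg_eq, reflAction_mk, freeAction_gen, coe_genAct]

/-! ### Functoriality -/

section Functoriality

variable {W : Type v} [AddCommGroup W] [Module (WreathAlg n lam ν) W] [Module k W]
  [IsScalarTower k (WreathAlg n lam ν) W] (f : V →ₗ[WreathAlg n lam ν] W)
  (x : Amb (n := n) i V)

/-- On each summand `F_i(f)` is `f` applied to all components. Slot maps only reindex components or
insert zeros, so they commute with it, and the operators built from them inherit this. -/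
theorem compLeft_raise (r : EdgesInto i) (p : Fin n) :
    f.compLeft _ (raise k r p x) = raise k r p (f.compLeft _ x) := by
  funext ξ
  by_cases h : ξ p = some r <;> simp [raise_apply, h]

theorem compLeft_lower (r : EdgesInto i) (p : Fin n) :
    f.compLeft _ (lower k r p x) = lower k r p (f.compLeft _ x) := by
  funext ξ
  by_cases h : ξ p = none <;> simp [lower_apply, h]

theorem compLeft_permAct (σ : Equiv.Perm (Fin n)) :
    f.compLeft _ (permAct lam ν σ x) = permAct lam ν σ (f.compLeft _ x) := by
  funext ξ
  exact map_smul f _ _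

theorem compLeft_contract (p : Fin n) :
    f.compLeft _ (contract lam ν p x) = contract lam ν p (f.compLeft _ x) := by
  simp only [contract_eq_sum, map_sum, compLeft_lower, map_smul]

theorem compLeft_expand (p : Fin n) :
    f.compLeft _ (expand lam ν p x) = expand lam ν p (f.compLeft _ x) := by
  simp only [expand_eq_sum, map_sum, compLeft_raise, map_smul]

theorem compLeft_shift (l : Fin n) (D : Finset (Fin n)) :
    f.compLeft _ (shift lam ν l D x) = shift lam ν l D (f.compLeft _ x) := by
  simp only [shift_apply, map_add, map_neg, map_sum, LinearMap.map_smul_of_tower, compLeft_expand,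
    compLeft_contract, compLeft_permAct]

theorem compLeft_primeAct (a : DoubleEdge I) (l : Fin n) (j : Fin n → I) :
    f.compLeft _ (primeAct lam ν a l j x) = primeAct lam ν a l j (f.compLeft _ x) := by
  rcases doubleEdge_cases i a with h | ⟨r, rfl⟩ | ⟨r, rfl⟩
  · rw [primeAct_avoids _ _ _ h, primeAct_avoids _ _ _ h, map_smul]
  · rw [primeAct_raise, primeAct_raise, compLeft_shift, compLeft_raise]
  · rw [primeAct_lower, primeAct_lower, compLeft_lower]

theorem reflMap_genAct (g : Gen I n) (x : reflSpace n lam ν i V) :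
    reflMap lam ν i f (genAct hi g x) = genAct hi g (reflMap lam ν i f x) := by
  refine Subtype.ext (funext fun j' => ?_)
  change f.compLeft _ (genOp lam ν g x.1 j')
    = genOp lam ν g (fun j => f.compLeft _ (x.1 j)) j'
  rcases g with j | ⟨a, l, j⟩ | σ
  · rw [genOp_idem, genOp_idem]
    by_cases h : j' = j
    · subst h
      rw [Pi.single_eq_same, Pi.single_eq_same]
    · rw [Pi.single_eq_of_ne h, Pi.single_eq_of_ne h, map_zero]
  · by_cases hj : j l = tail a
    · rw [genOp_edge _ hj, genOp_edge _ hj]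
      by_cases h : j' = moveTuple a l j
      · subst h
        rw [Pi.single_eq_same, Pi.single_eq_same, compLeft_primeAct]
      · rw [Pi.single_eq_of_ne h, Pi.single_eq_of_ne h, map_zero]
    · rw [genOp_edge_of_ne _ hj, genOp_edge_of_ne _ hj]
      exact map_zero _
  · rw [genOp_perm, genOp_perm, compLeft_permAct]

theorem reflMap_freeAction (a : FreeAlgebra k (Gen I n)) :
    ∀ x : reflSpace n lam ν i V, reflMap lam ν i f (freeAction lam ν V hi a x)
      = freeAction lam ν W hi a (reflMap lam ν i f x) := by
  induction a using FreeAlgebra.induction with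
  | grade0 c =>
    intro x
    rw [AlgHom.commutes, AlgHom.commutes, Module.algebraMap_end_apply, Module.algebraMap_end_apply]
    refine Subtype.ext (funext fun j => ?_)
    exact LinearMap.map_smul_of_tower (f.compLeft _) c (x.1 j)
  | grade1 g =>
    intro x
    rw [freeAction_gen, freeAction_gen, reflMap_genAct]
  | mul a b ha hb =>
    intro x
    rw [map_mul, map_mul, Module.End.mul_apply, Module.End.mul_apply, ha, hb]
  | add a b ha hb =>
    intro x
    rw [map_add, map_add, LinearMap.add_apply, LinearMap.add_apply, map_add, ha, hb]

/-- The algebra is an iterated quotient of the free algebra, so compatibility with generators and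
scalars is enough. -/
theorem reflMap_reflAction (c : WreathAlg n (dualReflection i lam) ν)
    (x : reflSpace n lam ν i V) : reflMap lam ν i f (reflAction lam ν V hi c x)
      = reflAction lam ν W hi c (reflMap lam ν i f x) := by
  obtain ⟨c, rfl⟩ := RingQuot.mkAlgHom_surjective k _ c
  obtain ⟨a, rfl⟩ := RingQuot.mkAlgHom_surjective k _ c
  rw [reflAction_mk, reflAction_mk, reflMap_freeAction]

end Functoriality

end Action

/-! ### The scalar action of `k` on a module given only over the algebra. -/

section Scalars

variable {k : Type uk} [CommRing k] (A : Type*) [Ring A] [Algebra k A] (V : Type v)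
  [AddCommGroup V] [Module A V]

/-- The scalar action of `k` on a module over a `k`-algebra. -/
abbrev scalarModule : Module k V := Module.compHom V (algebraMap k A)

theorem scalarModule_isScalarTower : letI := scalarModule (k := k) A V; IsScalarTower k A V :=
  letI := scalarModule (k := k) A V
  ⟨fun c a v => by
    rw [Algebra.smul_def, mul_smul]
    rfl⟩

end Scalars

/-! ### The module structure on `F_i(V)`, and its agreement with the prescribed action. -/

section ReflectionModule

variable {k : Type uk} [CommRing k] {I : Type uI} [Fintype I] [DecidableEq I]
  [Quiver.{w} I] [Fintype (Quiver.Total.{w, uI} I)]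
  [DecidableEq (Quiver.Total.{w, uI} I)] {n : ℕ} (lam : I → k) (ν : k) {i : I}
  (hi : ∀ a : Quiver.Total.{w, uI} I, a.left ≠ i)
  (V : Type v) [AddCommGroup V] [Module (WreathAlg n lam ν) V]

/-- The `𝓐_{n, r_i λ, ν}`-module structure on `F_i(V)`. -/
abbrev reflModule : Module (WreathAlg n (dualReflection i lam) ν) (reflSpace n lam ν i V) :=
  letI := scalarModule (k := k) (WreathAlg n lam ν) V
  haveI := scalarModule_isScalarTower (k := k) (WreathAlg n lam ν) V
  Module.compHom _ (reflAction lam ν V hi).toRingHom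

theorem isReflectionAction_reflModule :
    IsReflectionAction (n := n) lam ν i V (reflModule lam ν hi V) := by
  let := scalarModule (k := k) (WreathAlg n lam ν) V
  have := scalarModule_isScalarTower (k := k) (WreathAlg n lam ν) V
  let := reflModule (n := n) lam ν hi V
  have hsmul : ∀ (c : WreathAlg n (dualReflection i lam) ν) (x : reflSpace n lam ν i V),
      c • x = reflAction lam ν V hi c x := fun _ _ => rfl
  have hx : ∀ (x : reflSpace n lam ν i V) j, x.1 j ∈ sumSpace lam ν i V j (Delta i j) :=
    fun x j => (mem_kerSpace_iff.1 ((mem_reflSpace lam ν i x.1).1 x.2 j)).1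
  refine ⟨fun c x j ξ => ?_, fun j x => ?_, fun σ x j => ?_, fun a l j h x => ?_⟩
  · rw [hsmul, AlgHom.commutes]
    rfl
  · rw [hsmul, reflAction_toAlg, genOp_idem]
  · rw [hsmul, reflAction_toAlg, genOp_perm, permTuple_inv_permTuple, permOp_eq (hx x j)]
  · rw [hsmul, reflAction_toAlg, genOp_edge _ h, primeOp_eq hi (hx x j) a h]

theorem reflMap_smul {W : Type v} [AddCommGroup W] [Module (WreathAlg n lam ν) W]
    (f : V →ₗ[WreathAlg n lam ν] W) (c : WreathAlg n (dualReflection i lam) ν)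
    (x : reflSpace n lam ν i V) :
    letI := reflModule (n := n) lam ν hi V
    letI := reflModule (n := n) lam ν hi W
    reflMap lam ν i f (c • x) = c • reflMap lam ν i f x :=
  letI := scalarModule (k := k) (WreathAlg n lam ν) V
  haveI := scalarModule_isScalarTower (k := k) (WreathAlg n lam ν) V
  letI := scalarModule (k := k) (WreathAlg n lam ν) W
  haveI := scalarModule_isScalarTower (k := k) (WreathAlg n lam ν) W
  reflMap_reflAction hi f c x

end ReflectionModule

end

end WreathQuiver

theorem proposition2p6 {k : Type uk} [CommRing k] {I : Type uI} [Fintype I] [DecidableEq I]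
    [Quiver.{w} I] [Fintype (Quiver.Total.{w, uI} I)]
    [DecidableEq (Quiver.Total.{w, uI} I)] (n : ℕ) (hn : 0 < n) (lam : I → k) (ν : k)
    (i : I) (hi : ∀ a : Quiver.Total.{w, uI} I, a.left ≠ i) :
    ∃ F : ModuleCat.{v} (WreathQuiver.WreathAlg n lam ν) ⥤
        ModuleCat.{max uI w v}
          (WreathQuiver.WreathAlg n (WreathQuiver.dualReflection i lam) ν),
      ∃ (M : ∀ V : ModuleCat.{v} (WreathQuiver.WreathAlg n lam ν),
          Module (WreathQuiver.WreathAlg n (WreathQuiver.dualReflection i lam) ν)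
            (WreathQuiver.reflSpace n lam ν i V))
        (lin : ∀ (V W : ModuleCat.{v} (WreathQuiver.WreathAlg n lam ν))
          (f : V →ₗ[WreathQuiver.WreathAlg n lam ν] W)
          (c : WreathQuiver.WreathAlg n (WreathQuiver.dualReflection i lam) ν)
          (x : WreathQuiver.reflSpace n lam ν i V),
          WreathQuiver.reflMap lam ν i f (c • x) = c • WreathQuiver.reflMap lam ν i f x),
        (∀ V : ModuleCat.{v} (WreathQuiver.WreathAlg n lam ν),
          WreathQuiver.IsReflectionAction lam ν i V (M V)) ∧
        F = WreathQuiver.reflFunctor lam ν i M lin := by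
  refine ⟨WreathQuiver.reflFunctor lam ν i (fun V => WreathQuiver.reflModule lam ν hi V)
    (fun V _ f c x => WreathQuiver.reflMap_smul lam ν hi V f c x), _, _,
    fun V => WreathQuiver.isReflectionAction_reflModule lam ν hi V, rfl⟩
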